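/- **Conventions.** Let $\mathfrak M$ be the Boolean algebra of Borel subsets of $[0,1]$ modulo Lebesgue null sets and $\lambda$ Lebesgue measure on it. A measure on a Boolean algebra is a finitely additive probability measure; it is identified with the corresponding Radon probability measure on the Stone space (the space of ultrafilters). For a subalgebra $\mathbb B$ of $\mathcal P(\omega)$, each $n\in\omega$ is identified with the ultrafilter $\{A\in\mathbb B: n\in A\}$ in $\mathrm{Stone}(\mathbb B)$. For a compact Hausdorff space $K$ let $P(K)$ be the space of Radon probability measures on $K$ with the weak$^*$ topology. For $D\subseteq K$ let $S_0(D)$ be the set of finite convex combinations of Dirac measures $\delta_x$, $x\in D$, and for an ordinal $\alpha>0$ let $S_\alpha(D)\subseteq P(K)$ be the set of limits of convergent sequences all of whose terms lie in $\bigcup_{\beta<\alpha}S_\beta(D)$. A measure $\nu$ is orthogonal to $\mu$ (both on $\mathbb B$) if for every $\delta>0$ there is $F\in\mathbb B$ with $\nu(F)>1-\delta$ and $\mu(F)<\delta$. The pair $(\mathfrak M,\lambda)$ is metrically isomorphic to $(\mathbb B,\mu)$, witnessed by $\varphi:\mathfrak M\to\mathbb B$, if $M\mapsto[\varphi(M)]$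 is an isomorphism of Boolean algebras from $\mathfrak M$ onto $\mathbb B/\mathrm{Null}(\mu)$ with $\mu(\varphi(M))=\lambda(M)$ for all $M$. **The canonical construction.** Let $(B_n)_{n\in\omega}$ be a partition of $\omega$ into infinite sets, $B_n=\{x^n_0<x^n_1<\cdots\}$, and put $A^n=\{x^n_i:i\in A\}$ for $A\subseteq\omega$. Given, for each $n$, a subalgebra $\mathbb B_n$ of $\mathcal P(\omega)$ with a measure $\mu_n$, and a map $\varphi_n$ witnessing that $(\mathfrak M,\lambda)$ is metrically isomorphic to $(\mathbb B_n,\mu_n)$, put $\mathbb B_n^n=\{A^n:A\in\mathbb B_n\}$ and $\mu_n'(A)=\mu_n(\{i:x^n_i\in A\})$ for $A\in\mathbb B_n^n$. Let $\mathbb B$ be the subalgebra of $\mathcal P(\omega)$ generated by the sets $A\subseteq\omega$ such that $A\cap B_n\in\mathbb B_n^n$ for all $n$ and $\lim_n\mu_n'(A\cap B_n)=1$, together with the sets $\bigcup_n\varphi_n(M)^n$, $M\in\mathfrak M$. Let $\mu(A)=\lim_n\mu'_n(A\cap B_n)$ for $A\in\mathbb B$. **Theorem 2.3.** For each $n\in\omega$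 let $\mathbb B_n$ be a subalgebra of $\mathcal P(\omega)$ with a measure $\mu_n$, and let $K_n=\mathrm{Stone}(\mathbb B_n)$. Let $(\alpha_n)_n$ be a non-decreasing sequence of non-zero countable ordinals and $\alpha=\sup_n\alpha_n$. Assume that for each $n$ - $\mu_n\in S_{\alpha_n}(\omega)$; - $\mu_n$ is orthogonal to each member of $\bigcup_{\beta<\alpha_n}S_\beta(K_n)$; - $(\mathfrak M,\lambda)$ is metrically isomorphic to $(\mathbb B_n,\mu_n)$, witnessed by $\varphi_n$. Let $(\mathbb B,\mu)$ be constructed canonically from these data and let $K=\mathrm{Stone}(\mathbb B)$. Then $\mu$ is well defined (for all $A\in\mathbb B$, each $A\cap B_n$ lies in $\mathbb B_n^n$ and the limit exists) and is a measure on $\mathbb B$, and - if $\alpha=\alpha_n$ for some $n$, then $\mu\in S_{\alpha+1}(\omega)$ and $\mu$ is orthogonal to each member of $\bigcup_{\beta\le\alpha}S_\beta(K)$; - otherwise $\mu\in S_\alpha(\omega)$ and $\mu$ is orthogonal to each member of $\bigcup_{\beta<\alpha}S_\beta(K)$; - $(\mathfrak M,\lambda)$ is metrically isomorphic to $(\mathbb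 B,\mu)$. -/

import Mathlib

open MeasureTheory Filter Topology
open scoped NNReal Ordinal

noncomputable section

/-! ## Finitely additive probability measures on Boolean algebras -/

/-- A finitely additive probability measure on a Boolean algebra. -/
structure FinAddProb (A : Type*) [BooleanAlgebra A] where
  toFun : A → ℝ
  nonneg' : ∀ a, 0 ≤ toFun a
  top' : toFun ⊤ = 1
  sup' : ∀ a b, Disjoint a b → toFun (a ⊔ b) = toFun a + toFun b

namespace FinAddProb

variable {A : Type*} [BooleanAlgebra A]

instance : CoeFun (FinAddProb A) (fun _ => A → ℝ) := ⟨FinAddProb.toFun⟩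

/-- `m` is orthogonal to `m'`: for each `δ > 0` some `F` has `m F > 1 - δ` and `m' F < δ`. -/
def Orthogonal (m m' : FinAddProb A) : Prop :=
  ∀ δ : ℝ, 0 < δ → ∃ F : A, m F > 1 - δ ∧ m' F < δ

variable (m : FinAddProb A)

theorem apply_bot : m ⊥ = 0 := by
  have h := m.sup' ⊥ ⊥ disjoint_bot_left
  rw [bot_sup_eq] at h
  linarith

theorem apply_mono {a b : A} (h : a ≤ b) : m a ≤ m b := by
  have h1 := m.sup' a (b \ a) disjoint_sdiff_self_right
  rw [sup_sdiff_cancel_right h] at h1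
  linarith [m.nonneg' (b \ a)]

theorem apply_sup_le (a b : A) : m (a ⊔ b) ≤ m a + m b := by
  have h1 := m.sup' a (b \ a) disjoint_sdiff_self_right
  rw [sup_sdiff_self_right] at h1
  linarith [m.apply_mono (sdiff_le : b \ a ≤ b)]

theorem apply_eq_zero_of_le {a b : A} (h : a ≤ b) (hb : m b = 0) : m a = 0 :=
  le_antisymm (hb ▸ m.apply_mono h) (m.nonneg' a)

theorem apply_sup_eq_zero {a b : A} (ha : m a = 0) (hb : m b = 0) : m (a ⊔ b) = 0 :=
  le_antisymm (by linarith [m.apply_sup_le a b]) (m.nonneg' _)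

/-- Equality modulo the ideal `Null(m)`. -/
def nullSetoid : Setoid A where
  r a b := m (symmDiff a b) = 0
  iseqv :=
    { refl := fun a => by rw [symmDiff_self]; exact m.apply_bot
      symm := fun {a b} h => by rw [symmDiff_comm]; exact h
      trans := fun {a b c} h h' =>
        m.apply_eq_zero_of_le (symmDiff_triangle a b c) (m.apply_sup_eq_zero h h') }

/-- The quotient Boolean algebra `A / Null(m)`. -/
def NullQuot : Type _ := Quotient m.nullSetoid

/-- The class of `a` in `A / Null(m)`. -/
def cls (a : A) : m.NullQuot := Quotient.mk m.nullSetoid a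

theorem cls_eq_cls {a b : A} : m.cls a = m.cls b ↔ m (symmDiff a b) = 0 :=
  ⟨fun h => Quotient.exact h, fun h => Quotient.sound h⟩

theorem nullSetoid_compl {a b : A} (h : m (symmDiff a b) = 0) : m (symmDiff aᶜ bᶜ) = 0 := by
  rwa [compl_symmDiff_compl]

theorem nullSetoid_sup {a a' b b' : A} (h : m (symmDiff a a') = 0) (h' : m (symmDiff b b') = 0) :
    m (symmDiff (a ⊔ b) (a' ⊔ b')) = 0 := by
  refine m.apply_eq_zero_of_le ?_ (m.apply_sup_eq_zero h h')
  rw [symmDiff, symmDiff, symmDiff, sup_sdiff, sup_sdiff]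
  refine sup_le (sup_le ?_ ?_) (sup_le ?_ ?_)
  · exact (sdiff_le_sdiff_left le_sup_left).trans (le_sup_left.trans le_sup_left)
  · exact (sdiff_le_sdiff_left le_sup_right).trans (le_sup_left.trans le_sup_right)
  · exact (sdiff_le_sdiff_left le_sup_left).trans (le_sup_right.trans le_sup_left)
  · exact (sdiff_le_sdiff_left le_sup_right).trans (le_sup_right.trans le_sup_right)

theorem nullSetoid_inf {a a' b b' : A} (h : m (symmDiff a a') = 0) (h' : m (symmDiff b b') = 0) :
    m (symmDiff (a ⊓ b) (a' ⊓ b')) = 0 := by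
  have := m.nullSetoid_compl (m.nullSetoid_sup (m.nullSetoid_compl h) (m.nullSetoid_compl h'))
  simpa [compl_sup] using this

instance : Max m.NullQuot :=
  ⟨Quotient.map₂ (· ⊔ ·) (fun _ _ h _ _ h' => m.nullSetoid_sup h h')⟩

instance : Min m.NullQuot :=
  ⟨Quotient.map₂ (· ⊓ ·) (fun _ _ h _ _ h' => m.nullSetoid_inf h h')⟩

instance : Compl m.NullQuot :=
  ⟨Quotient.map (·ᶜ) (fun _ _ h => m.nullSetoid_compl h)⟩

theorem cls_surj (x : m.NullQuot) : ∃ a, m.cls a = x := Quotient.exists_rep x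

theorem cls_sup (a b : A) : m.cls (a ⊔ b) = m.cls a ⊔ m.cls b := rfl

theorem cls_inf (a b : A) : m.cls (a ⊓ b) = m.cls a ⊓ m.cls b := rfl

theorem cls_compl (a : A) : m.cls aᶜ = (m.cls a)ᶜ := rfl

/-- The lattice operations of `A / Null(m)` are those induced from `A`. -/
instance : Lattice m.NullQuot :=
  Lattice.mk'
    (fun x y => by
      obtain ⟨a, rfl⟩ := m.cls_surj x
      obtain ⟨b, rfl⟩ := m.cls_surj y
      rw [← cls_sup, ← cls_sup, sup_comm])
    (fun x y z => by
      obtain ⟨a, rfl⟩ := m.cls_surj x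
      obtain ⟨b, rfl⟩ := m.cls_surj y
      obtain ⟨c, rfl⟩ := m.cls_surj z
      simp only [← cls_sup, sup_assoc])
    (fun x y => by
      obtain ⟨a, rfl⟩ := m.cls_surj x
      obtain ⟨b, rfl⟩ := m.cls_surj y
      rw [← cls_inf, ← cls_inf, inf_comm])
    (fun x y z => by
      obtain ⟨a, rfl⟩ := m.cls_surj x
      obtain ⟨b, rfl⟩ := m.cls_surj y
      obtain ⟨c, rfl⟩ := m.cls_surj z
      simp only [← cls_inf, inf_assoc])
    (fun x y => by
      obtain ⟨a, rfl⟩ := m.cls_surj x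
      obtain ⟨b, rfl⟩ := m.cls_surj y
      rw [← cls_inf, ← cls_sup, sup_inf_self])
    (fun x y => by
      obtain ⟨a, rfl⟩ := m.cls_surj x
      obtain ⟨b, rfl⟩ := m.cls_surj y
      rw [← cls_sup, ← cls_inf, inf_sup_self])

instance : DistribLattice m.NullQuot :=
  DistribLattice.ofInfSupLe (fun x y z => by
    obtain ⟨a, rfl⟩ := m.cls_surj x
    obtain ⟨b, rfl⟩ := m.cls_surj y
    obtain ⟨c, rfl⟩ := m.cls_surj z
    have h : m.cls a ⊓ (m.cls b ⊔ m.cls c) = m.cls a ⊓ m.cls b ⊔ m.cls a ⊓ m.cls c := by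
      change m.cls (a ⊓ (b ⊔ c)) = m.cls (a ⊓ b ⊔ a ⊓ c)
      rw [inf_sup_left]
    exact h.le)

instance : BooleanAlgebra m.NullQuot where
  top := m.cls ⊤
  bot := m.cls ⊥
  le_top x := by
    obtain ⟨a, rfl⟩ := m.cls_surj x
    refine sup_eq_right.1 ?_
    change m.cls (a ⊔ ⊤) = m.cls ⊤
    rw [sup_top_eq]
  bot_le x := by
    obtain ⟨a, rfl⟩ := m.cls_surj x
    refine sup_eq_right.1 ?_
    change m.cls (⊥ ⊔ a) = m.cls a
    rw [bot_sup_eq]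
  inf_compl_le_bot x := by
    obtain ⟨a, rfl⟩ := m.cls_surj x
    refine le_of_eq ?_
    change m.cls (a ⊓ aᶜ) = m.cls ⊥
    rw [inf_compl_self]
  top_le_sup_compl x := by
    obtain ⟨a, rfl⟩ := m.cls_surj x
    refine le_of_eq ?_
    change m.cls ⊤ = m.cls (a ⊔ aᶜ)
    rw [sup_compl_eq_top]

theorem apply_eq_of_null {a b : A} (h : m (symmDiff a b) = 0) : m a = m b := by
  have key : ∀ a b : A, m (symmDiff a b) = 0 → m a ≤ m b := fun a b h => by
    have h1 : a ≤ b ⊔ symmDiff a b := by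
      rw [sup_comm]
      exact le_symmDiff_sup_right a b
    linarith [m.apply_mono h1, m.apply_sup_le b (symmDiff a b)]
  exact le_antisymm (key a b h) (key b a (by rwa [symmDiff_comm]))

/-- The measure that `m` induces on `A / Null(m)`: the class of `a` has measure `m a`. -/
def quot : FinAddProb m.NullQuot where
  toFun := Quotient.lift m.toFun (fun _ _ h => m.apply_eq_of_null h)
  nonneg' x := by
    obtain ⟨a, rfl⟩ := m.cls_surj x
    exact m.nonneg' a
  top' := m.top'
  sup' x y h := by
    obtain ⟨a, rfl⟩ := m.cls_surj x
    obtain ⟨b, rfl⟩ := m.cls_surj y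
    have h0 : m.cls (a ⊓ b) = m.cls ⊥ := h.eq_bot
    rw [cls_eq_cls, symmDiff_bot] at h0
    change m (a ⊔ b) = m a + m b
    have h1 := m.sup' a (b \ a) disjoint_sdiff_self_right
    rw [sup_sdiff_self_right] at h1
    have h2 := m.sup' (b ⊓ a) (b \ a) disjoint_inf_sdiff
    rw [sup_inf_sdiff, inf_comm, h0] at h2
    linarith

/-- `(A, m)` is metrically isomorphic to `(C, m')`, witnessed by `φ : A → C`: the map
`a ↦ [φ a]` is a measure preserving isomorphism of Boolean algebras from `A` onto `C / Null(m')`.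
(Isomorphisms of Boolean algebras are the same as order isomorphisms.) -/
def MetricIsoVia {C : Type*} [BooleanAlgebra C] (m : FinAddProb A) (m' : FinAddProb C)
    (φ : A → C) : Prop :=
  ∃ e : A ≃o m'.NullQuot, ∀ a, e a = m'.cls (φ a) ∧ m'.quot (e a) = m a

end FinAddProb

/-! ## The Lebesgue measure algebra -/

/-- Lebesgue measure on the Boolean algebra of Borel subsets of `[0,1]`. -/
def borelLebesgue : FinAddProb {s : Set unitInterval // MeasurableSet s} where
  toFun s := (volume : Measure unitInterval).real s.1
  nonneg' _ := measureReal_nonneg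
  top' := by
    change (volume : Measure unitInterval).real Set.univ = 1
    simp
  sup' a b h := by
    refine measureReal_union ?_ b.2
    rw [disjoint_iff] at h ⊢
    exact congrArg Subtype.val h

/-- The Boolean algebra of Borel subsets of `[0,1]` modulo Lebesgue null sets. -/
abbrev LebesgueAlgebra : Type := borelLebesgue.NullQuot

/-- Lebesgue measure on `LebesgueAlgebra`. -/
abbrev lebesgueAlgebraMeasure : FinAddProb LebesgueAlgebra := borelLebesgue.quot

/-! ## Stone spaces -/

/-- Ultrafilters on a Boolean algebra. -/
@[ext]
structure StoneSpace (A : Type*) [BooleanAlgebra A] where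
  carrier : Set A
  top_mem' : ⊤ ∈ carrier
  bot_notMem' : ⊥ ∉ carrier
  inf_mem' : ∀ a b, a ∈ carrier → b ∈ carrier → a ⊓ b ∈ carrier
  mem_of_le' : ∀ a b, a ≤ b → a ∈ carrier → b ∈ carrier
  mem_or_compl_mem' : ∀ a, a ∈ carrier ∨ aᶜ ∈ carrier

namespace StoneSpace

variable {A : Type*} [BooleanAlgebra A]

/-- The basic clopen set `{u | a ∈ u}` of the Stone space. -/
def basic (a : A) : Set (StoneSpace A) := {u | a ∈ u.carrier}

instance : TopologicalSpace (StoneSpace A) := TopologicalSpace.generateFrom (Set.range basic)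

instance : MeasurableSpace (StoneSpace A) := borel (StoneSpace A)

instance : BorelSpace (StoneSpace A) := ⟨rfl⟩

theorem isOpen_basic (a : A) : IsOpen (basic a) :=
  TopologicalSpace.isOpen_generateFrom_of_mem ⟨a, rfl⟩

theorem basic_top : basic (⊤ : A) = Set.univ :=
  Set.eq_univ_of_forall fun u => u.top_mem'

theorem basic_sup (a b : A) : basic (a ⊔ b) = basic a ∪ basic b := by
  ext u
  constructor
  · intro h
    rcases u.mem_or_compl_mem' a with ha | ha
    · exact Or.inl ha
    · refine Or.inr (u.mem_of_le' _ _ ?_ (u.inf_mem' _ _ h ha))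
      rw [inf_sup_right, inf_compl_self, bot_sup_eq]
      exact inf_le_left
  · rintro (h | h)
    · exact u.mem_of_le' _ _ le_sup_left h
    · exact u.mem_of_le' _ _ le_sup_right h

theorem disjoint_basic {a b : A} (h : Disjoint a b) : Disjoint (basic a) (basic b) := by
  rw [Set.disjoint_left]
  intro u ha hb
  have hab := u.inf_mem' _ _ ha hb
  rw [h.eq_bot] at hab
  exact u.bot_notMem' hab

/-- The ultrafilter `{B ∈ 𝔹 | n ∈ B}` on an algebra `𝔹` of subsets of `ℕ`. -/
def principal (𝔹 : BooleanSubalgebra (Set ℕ)) (n : ℕ) : StoneSpace 𝔹 where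
  carrier := {a | n ∈ (a : Set ℕ)}
  top_mem' := Set.mem_univ n
  bot_notMem' := Set.notMem_empty n
  inf_mem' _ _ ha hb := ⟨ha, hb⟩
  mem_of_le' _ _ h ha := h ha
  mem_or_compl_mem' a := Classical.em (n ∈ (a : Set ℕ))

end StoneSpace

/-! ## The sequential hierarchy -/

/-- `P(K)`: the regular (Radon) Borel probability measures on `K`, with the weak topology
(convergence of the integrals of all bounded continuous functions). -/
abbrev RadonProb (K : Type*) [TopologicalSpace K] [MeasurableSpace K] : Type _ :=
  {ν : ProbabilityMeasure K // (ν : Measure K).Regular}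

/-- `conv(δ_x : x ∈ D)`: convex combinations of Dirac measures at points of `D`. -/
def convDirac {K : Type*} [TopologicalSpace K] [MeasurableSpace K] (D : Set K) :
    Set (RadonProb K) :=
  {ν | ∃ (t : Finset K) (w : K → ℝ≥0), (t : Set K) ⊆ D ∧ ∑ x ∈ t, w x = 1 ∧
    (ν.1 : Measure K) = ∑ x ∈ t, w x • Measure.dirac x}

/-- The sequential hierarchy: `S_0(D) = conv(δ_x : x ∈ D)`, and for `α > 0` the set `S_α(D)`
consists of the limits of sequences all of whose terms lie in `⋃_{β < α} S_β(D)`. -/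
def seqLevel {K : Type*} [TopologicalSpace K] [MeasurableSpace K] [OpensMeasurableSpace K]
    (D : Set K) (α : Ordinal.{0}) : Set (RadonProb K) :=
  {ν | (α = 0 ∧ ν ∈ convDirac D) ∨
    (α ≠ 0 ∧ ∃ s : ℕ → RadonProb K,
      (∀ n, ∃ β, ∃ _ : β < α, s n ∈ seqLevel D β) ∧ Tendsto s atTop (𝓝 ν))}
termination_by α

/-- The finitely additive measure `a ↦ ν {u | a ∈ u}` on `A` that corresponds to a Radon
probability measure `ν` on the Stone space of `A`. -/
def RadonProb.toFinAddProb {A : Type*} [BooleanAlgebra A] (ν : RadonProb (StoneSpace A)) :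
    FinAddProb A where
  toFun a := (ν.1 : Measure (StoneSpace A)).real (StoneSpace.basic a)
  nonneg' _ := measureReal_nonneg
  top' := by rw [StoneSpace.basic_top]; simp
  sup' a b h := by
    rw [StoneSpace.basic_sup]
    exact measureReal_union (StoneSpace.disjoint_basic h) (StoneSpace.isOpen_basic b).measurableSet

/-- `m ∈ S_α(ω)` for a finitely additive probability measure `m` on an algebra `𝔹` of subsets of
`ℕ`: the Radon measure on the Stone space corresponding to `m` is in `S_α(ω)`, where `ω` stands
for the set of principal ultrafilters. -/
def FinAddProb.MemLevel {𝔹 : BooleanSubalgebra (Set ℕ)} (m : FinAddProb 𝔹) (α : Ordinal.{0}) :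
    Prop :=
  ∃ ν ∈ seqLevel (Set.range (StoneSpace.principal 𝔹)) α, RadonProb.toFinAddProb ν = m

/-- `m` is orthogonal to each member of `S_α(K)`, `K` the Stone space of `𝔹`. -/
def FinAddProb.OrthogonalToLevel {𝔹 : BooleanSubalgebra (Set ℕ)} (m : FinAddProb 𝔹)
    (α : Ordinal.{0}) : Prop :=
  ∀ ν ∈ seqLevel (Set.univ : Set (StoneSpace 𝔹)) α, m.Orthogonal (RadonProb.toFinAddProb ν)

/-! ## The canonical construction -/

/-- `A^n = {x_i | i ∈ A}`, where `x_0 < x_1 < ⋯` enumerates the infinite set `b = B_n`. -/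
def copyIn (b : Set ℕ) (A : Set ℕ) : Set ℕ := (fun i => Nat.nth (· ∈ b) i) '' A

/-- `𝔹^n = {A^n | A ∈ 𝔹}`. -/
def copyAlg (b : Set ℕ) (𝔹 : BooleanSubalgebra (Set ℕ)) : Set (Set ℕ) :=
  copyIn b '' (𝔹 : Set (Set ℕ))

open scoped Classical in
/-- `m'(A) = m {i | x_i ∈ A}`, for `A` in `copyAlg b 𝔹`; the junk value is `0` for a set `A` for
which `{i | x_i ∈ A}` is not in `𝔹`. -/
def copyMeasure (b : Set ℕ) {𝔹 : BooleanSubalgebra (Set ℕ)} (m : FinAddProb 𝔹) (A : Set ℕ) : ℝ :=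
  if h : {i | Nat.nth (· ∈ b) i ∈ A} ∈ 𝔹 then m ⟨{i | Nat.nth (· ∈ b) i ∈ A}, h⟩ else 0

/-- The family `𝓕` of the sets `A` with `A ∩ B_n ∈ 𝔹_n^n` for all `n` and
`lim_n μ'_n(A ∩ B_n) = 1`. -/
def canonicalFilter (B : ℕ → Set ℕ) (𝔹 : ℕ → BooleanSubalgebra (Set ℕ))
    (μ : ∀ n, FinAddProb (𝔹 n)) : Set (Set ℕ) :=
  {A | (∀ n, A ∩ B n ∈ copyAlg (B n) (𝔹 n)) ∧
    Tendsto (fun n => copyMeasure (B n) (μ n) (A ∩ B n)) atTop (𝓝 1)}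

/-- The algebra generated by `𝓕` and the sets `⋃_n φ_n(M)^n`, `M` in the Lebesgue algebra. -/
def canonicalAlgebra (B : ℕ → Set ℕ) (𝔹 : ℕ → BooleanSubalgebra (Set ℕ))
    (μ : ∀ n, FinAddProb (𝔹 n)) (φ : ∀ n, LebesgueAlgebra → 𝔹 n) : BooleanSubalgebra (Set ℕ) :=
  BooleanSubalgebra.closure (canonicalFilter B 𝔹 μ ∪
    Set.range fun M : LebesgueAlgebra => ⋃ n, copyIn (B n) (φ n M : Set ℕ))

/-- `m` is the measure `m(A) = lim_n μ'_n(A ∩ B_n)` on the canonical algebra; in particular every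
`A ∩ B_n` is in the domain of `μ'_n` and every limit exists. -/
def IsCanonicalMeasure (B : ℕ → Set ℕ) (𝔹 : ℕ → BooleanSubalgebra (Set ℕ))
    (μ : ∀ n, FinAddProb (𝔹 n)) (φ : ∀ n, LebesgueAlgebra → 𝔹 n)
    (m : FinAddProb (canonicalAlgebra B 𝔹 μ φ)) : Prop :=
  ∀ A : canonicalAlgebra B 𝔹 μ φ, (∀ n, (A : Set ℕ) ∩ B n ∈ copyAlg (B n) (𝔹 n)) ∧
    Tendsto (fun n => copyMeasure (B n) (μ n) ((A : Set ℕ) ∩ B n)) atTop (𝓝 (m A))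

end

/-!
Write `T n A = {i | x^n_i ∈ A}` for the trace of `A ⊆ ω` on the block `B n`. The canonical algebra
consists of the sets `A` with `T n A ∈ 𝔹 n` for which some `M` in the Lebesgue algebra has
`μ n (T n A ∆ φ n M) → 0` (`mem_canonicalAlgebra_iff`): such sets form an algebra since `φ n` is a
homomorphism up to null sets, and each differs from a generator `⋃ φ n (M)^n` by the complement of
another generator. Hence `μ n (T n A)` converges to the Lebesgue measure of `M`, the limit is
additive, and `M ↦ ⋃ φ n (M)^n` is a metric isomorphism (`metricIsoVia_canonicalMap`).

The trace maps are homomorphisms `𝔹 → 𝔹 n`, dual to continuous maps from the Stone space of `𝔹 n`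
to that of `𝔹` which respect principal ultrafilters. The images of the `μ n` converge weakly to a
Radon measure corresponding to the canonical measure (`exists_radonProb_tendsto`), and continuous
images respect the sequential hierarchy (`condMap_mem_seqLevel`); this gives the upper bound on the
level.

Orthogonality to level `β ≤ a N` is an induction on `β`. Level zero is the fact that the Lebesgue
algebra has no atoms. For larger `β` let `ν` be the limit of measures `ν k` of levels below `β`. The
canonical measure is orthogonal to each `ν k` by induction. For `n ≥ N` the measure `μ n` is
orthogonal to `ν k` restricted to the clopen set of the `n`-th block, because normalized
restrictions to clopen sets stay at the same level. `ν` itself need not be orthogonal to `μ n`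
there, but the total mass of `ν` on all late blocks is small, and for fixed `n` all but finitely
many `ν k` have hardly more mass on the `n`-th block than `ν`. A diagonal choice over the blocks
combines these facts (`orthogonal_of_tendsto`).
-/

/-! ### Stone spaces -/

namespace StoneSpace

variable {A A' : Type*} [BooleanAlgebra A] [BooleanAlgebra A']

theorem basic_compl (a : A) : basic aᶜ = (basic a)ᶜ := by
  ext u
  refine ⟨fun h h' => u.bot_notMem' ?_, fun h => (u.mem_or_compl_mem' a).resolve_left h⟩
  simpa using u.inf_mem' _ _ h' h

theorem basic_inf (a b : A) : basic (a ⊓ b) = basic a ∩ basic b := by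
  ext u
  exact ⟨fun h => ⟨u.mem_of_le' _ _ inf_le_left h, u.mem_of_le' _ _ inf_le_right h⟩,
    fun h => u.inf_mem' _ _ h.1 h.2⟩

theorem basic_bot : basic (⊥ : A) = ∅ :=
  Set.eq_empty_of_forall_notMem fun u => u.bot_notMem'

theorem isClopen_basic (a : A) : IsClopen (basic a) :=
  ⟨⟨by rw [← basic_compl]; exact isOpen_basic _⟩, isOpen_basic a⟩

theorem exists_mem_of_sup_mem {ι : Type*} (u : StoneSpace A) (t : Finset ι) (f : ι → A)
    (h : t.sup f ∈ u.carrier) : ∃ i ∈ t, f i ∈ u.carrier := by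
  classical
  induction t using Finset.induction_on with
  | empty => exact absurd h u.bot_notMem'
  | insert i t _ ih =>
    rw [Finset.sup_insert] at h
    rcases (basic_sup (f i) (t.sup f)).subset h with h | h
    · exact ⟨i, Finset.mem_insert_self _ _, h⟩
    · obtain ⟨j, hj, hj'⟩ := ih h
      exact ⟨j, Finset.mem_insert_of_mem hj, hj'⟩

theorem exists_mem_notMem {u v : StoneSpace A} (h : u ≠ v) :
    ∃ a, a ∈ u.carrier ∧ a ∉ v.carrier := by
  by_contra! hc
  refine h (StoneSpace.ext (Set.Subset.antisymm hc fun a ha => ?_))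
  refine (u.mem_or_compl_mem' a).resolve_right fun h' => ?_
  exact v.bot_notMem' (by simpa using v.inf_mem' _ _ ha (hc _ h'))

instance : T2Space (StoneSpace A) where
  t2 u v h := by
    obtain ⟨a, ha, ha'⟩ := exists_mem_notMem h
    exact ⟨basic a, basic aᶜ, isOpen_basic _, isOpen_basic _, ha,
      (v.mem_or_compl_mem' a).resolve_left ha', disjoint_basic disjoint_compl_right⟩

instance : CompactSpace (StoneSpace A) where
  isCompact_univ := by
    rw [isCompact_iff_ultrafilter_le_nhds]
    intro F _
    -- `F` converges to the ultrafilter of all `a` whose clopen set is in `F`.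
    refine ⟨⟨{a | basic a ∈ F}, ?_, ?_, ?_, ?_, ?_⟩, Set.mem_univ _, ?_⟩
    · exact mem_of_superset univ_mem basic_top.ge
    · simp [basic_bot]
    · intro a b ha hb
      change basic (a ⊓ b) ∈ F
      rw [basic_inf]
      exact inter_mem ha hb
    · intro a b hab ha
      refine mem_of_superset ha ?_
      intro u hu
      exact u.mem_of_le' _ _ hab hu
    · intro a
      change basic a ∈ F ∨ basic aᶜ ∈ F
      rw [basic_compl]
      exact F.mem_or_compl_mem _
    · rw [TopologicalSpace.nhds_generateFrom]
      refine le_iInf₂ fun s hs => ?_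
      obtain ⟨hs, a, rfl⟩ := hs
      exact le_principal_iff.2 hs

/-- The continuous map of Stone spaces dual to a homomorphism of Boolean algebras. -/
def comap (f : BoundedLatticeHom A A') (u : StoneSpace A') : StoneSpace A where
  carrier := {a | f a ∈ u.carrier}
  top_mem' := by simpa using u.top_mem'
  bot_notMem' := by simpa using u.bot_notMem'
  inf_mem' a b ha hb := by simpa using u.inf_mem' _ _ ha hb
  mem_of_le' a b h ha := u.mem_of_le' _ _ (OrderHomClass.mono f h) ha
  mem_or_compl_mem' a := by simpa using u.mem_or_compl_mem' (f a)

theorem comap_preimage_basic (f : BoundedLatticeHom A A') (a : A) :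
    comap f ⁻¹' basic a = basic (f a) := rfl

theorem continuous_comap (f : BoundedLatticeHom A A') : Continuous (comap f) := by
  refine continuous_generateFrom_iff.2 ?_
  rintro _ ⟨a, rfl⟩
  exact isOpen_basic (f a)

/-- The indicator function of the clopen set `basic a`. -/
noncomputable def ind (a : A) : C(StoneSpace A, ℝ) where
  toFun := (basic a).indicator 1
  continuous_toFun := IsClopen.continuous_indicator (isClopen_basic a) continuous_one

theorem coe_ind (a : A) : ⇑(ind a) = (basic a).indicator 1 := rfl

theorem integral_ind (a : A) (ν : Measure (StoneSpace A)) :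
    ∫ x, ind a x ∂ν = ν.real (basic a) := by
  rw [coe_ind, integral_indicator_one (isOpen_basic a).measurableSet]

/-- The linear combinations of indicator functions of clopen sets are uniformly dense among the
continuous functions: they form an algebra, because the clopen sets are closed under
intersection, and separate points. -/
theorem dense_span_ind :
    Dense (Submodule.span ℝ (Set.range (ind : A → C(StoneSpace A, ℝ))) :
      Set C(StoneSpace A, ℝ)) := by
  have hcl : (Submonoid.closure (Set.range (ind : A → C(StoneSpace A, ℝ))) :
      Set C(StoneSpace A, ℝ)) = Set.range ind := by
    let S : Submonoid C(StoneSpace A, ℝ) :=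
      { carrier := Set.range ind
        one_mem' := ⟨⊤, by ext x; simp [coe_ind, basic_top]⟩
        mul_mem' := by
          rintro _ _ ⟨a, rfl⟩ ⟨b, rfl⟩
          refine ⟨a ⊓ b, ?_⟩
          ext x
          simp [coe_ind, basic_inf, Set.inter_indicator_one] }
    exact congrArg SetLike.coe (Submonoid.closure_eq S)
  have hsep : (Algebra.adjoin ℝ (Set.range (ind : A → C(StoneSpace A, ℝ)))).SeparatesPoints := by
    intro u v h
    obtain ⟨a, ha, ha'⟩ := exists_mem_notMem h
    refine ⟨_, ⟨ind a, Algebra.subset_adjoin ⟨a, rfl⟩, rfl⟩, ?_⟩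
    have h1 : u ∈ basic a := ha
    have h2 : v ∉ basic a := ha'
    simp [coe_ind, h1, h2]
  have h := ContinuousMap.subalgebra_topologicalClosure_eq_top_of_separatesPoints _ hsep
  rw [dense_iff_closure_eq]
  have h' := congrArg (SetLike.coe) h
  rw [Subalgebra.topologicalClosure_coe, ← Subalgebra.coe_toSubmodule, Algebra.adjoin_eq_span,
    hcl] at h'
  simpa using h'

end StoneSpace

namespace RadonProb

variable {K : Type*} [TopologicalSpace K] [MeasurableSpace K] [OpensMeasurableSpace K]

theorem tendsto_iff_integral {ι : Type*} {l : Filter ι} {s : ι → RadonProb K} {ν : RadonProb K} :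
    Tendsto s l (𝓝 ν) ↔ ∀ f : BoundedContinuousFunction K ℝ,
      Tendsto (fun i => ∫ x, f x ∂((s i).1 : Measure K)) l (𝓝 (∫ x, f x ∂(ν.1 : Measure K))) := by
  rw [tendsto_subtype_rng, ProbabilityMeasure.tendsto_iff_forall_integral_tendsto]

theorem tendsto_real_of_isClopen {ι : Type*} {l : Filter ι} {s : ι → RadonProb K}
    {ν : RadonProb K} (h : Tendsto s l (𝓝 ν)) {C : Set K} (hC : IsClopen C) :
    Tendsto (fun i => ((s i).1 : Measure K).real C) l (𝓝 ((ν.1 : Measure K).real C)) := by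
  have := tendsto_iff_integral.1 h (BoundedContinuousFunction.indicator C hC)
  have key (M : Measure K) :
      ∫ x, BoundedContinuousFunction.indicator C hC x ∂M = M.real C :=
    integral_indicator_one hC.isOpen.measurableSet
  simp_rw [← key]
  exact this

end RadonProb

section Limit

variable {A : Type*} [BooleanAlgebra A]

theorem FinAddProb.eq_of_apply_eq {m m' : FinAddProb A} (h : ∀ a, m a = m' a) : m = m' := by
  obtain ⟨f, _, _, _⟩ := m
  obtain ⟨g, _, _, _⟩ := m'
  congr
  exact funext h

/-- Weak limits of Radon measures on a Stone space can be computed on the Boolean algebra: if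
`s n a` converges to `m a` for all `a`, then `m` corresponds to a Radon measure, and that measure
is the weak limit of the `s n`. The positive functional `f ↦ lim ∫ f d(s n)` is everywhere
defined as the functions for which the limit exists form a closed subspace. -/
theorem exists_radonProb_tendsto (s : ℕ → RadonProb (StoneSpace A)) (m : FinAddProb A)
    (h : ∀ a, Tendsto (fun n => RadonProb.toFinAddProb (s n) a) atTop (𝓝 (m a))) :
    ∃ ν : RadonProb (StoneSpace A), RadonProb.toFinAddProb ν = m ∧ Tendsto s atTop (𝓝 ν) := by
  have hint (n : ℕ) (f : C(StoneSpace A, ℝ)) :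
      Integrable f ((s n).1 : Measure (StoneSpace A)) :=
    f.continuous.integrable_of_hasCompactSupport (HasCompactSupport.of_compactSpace f)
  have hspan : ∀ f ∈ Submodule.span ℝ (Set.range (StoneSpace.ind : A → C(StoneSpace A, ℝ))),
      ∃ l : ℝ, Tendsto (fun n => ∫ x, f x ∂((s n).1 : Measure (StoneSpace A))) atTop (𝓝 l) := by
    intro f hf
    induction hf using Submodule.span_induction with
    | mem f hf =>
      obtain ⟨a, rfl⟩ := hf
      refine ⟨m a, ?_⟩
      simp_rw [StoneSpace.integral_ind]
      exact h a
    | zero => exact ⟨0, by simp⟩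
    | add f g _ _ hf hg =>
      obtain ⟨l, hl⟩ := hf
      obtain ⟨l', hl'⟩ := hg
      refine ⟨l + l', (hl.add hl').congr fun n => ?_⟩
      exact (integral_add (hint n f) (hint n g)).symm
    | smul c f _ hf =>
      obtain ⟨l, hl⟩ := hf
      refine ⟨c * l, (hl.const_mul c).congr fun n => ?_⟩
      exact (integral_const_mul c _).symm
  have hex : ∀ f : C(StoneSpace A, ℝ),
      ∃ l : ℝ, Tendsto (fun n => ∫ x, f x ∂((s n).1 : Measure (StoneSpace A))) atTop (𝓝 l) := by
    intro f
    refine cauchySeq_tendsto_of_complete (Metric.cauchySeq_iff'.2 fun ε hε => ?_)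
    obtain ⟨g, hg, hfg⟩ := Metric.dense_iff.1 StoneSpace.dense_span_ind f (ε / 3) (by positivity)
    obtain ⟨l, hl⟩ := hspan g hfg
    obtain ⟨N, hN⟩ := Metric.cauchySeq_iff'.1 hl.cauchySeq (ε / 3) (by positivity)
    have hclose (n : ℕ) : dist (∫ x, f x ∂((s n).1 : Measure (StoneSpace A)))
        (∫ x, g x ∂((s n).1 : Measure (StoneSpace A))) ≤ ε / 3 := by
      rw [dist_eq_norm, ← integral_sub (hint n f) (hint n g)]
      refine (norm_integral_le_of_norm_le_const (C := ε / 3) (Eventually.of_forall fun x => ?_)).trans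
        (by simp)
      rw [← dist_eq_norm, dist_comm]
      exact (ContinuousMap.dist_apply_le_dist x).trans (Metric.mem_ball.1 hg).le
    refine ⟨N, fun n hn => ?_⟩
    have h1 := hclose n
    have h2 := hclose N
    rw [dist_comm] at h2
    have h3 := hN n hn
    linarith [dist_triangle4 (∫ x, f x ∂((s n).1 : Measure (StoneSpace A)))
      (∫ x, g x ∂((s n).1 : Measure (StoneSpace A))) (∫ x, g x ∂((s N).1 : Measure (StoneSpace A)))
      (∫ x, f x ∂((s N).1 : Measure (StoneSpace A)))]
  choose Λ hΛ using hex
  let Λ' : CompactlySupportedContinuousMap (StoneSpace A) ℝ →ₚ[ℝ] ℝ :=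
    { toFun := fun g => Λ g.toContinuousMap
      map_add' := fun f g => by
        refine tendsto_nhds_unique (hΛ _) (((hΛ f.toContinuousMap).add (hΛ g.toContinuousMap)).congr
          fun n => ?_)
        exact (integral_add (hint n _) (hint n _)).symm
      map_smul' := fun c f => by
        refine tendsto_nhds_unique (hΛ _) (((hΛ f.toContinuousMap).const_mul c).congr fun n => ?_)
        exact (integral_const_mul c _).symm
      monotone' := fun f g hfg => by
        refine le_of_tendsto_of_tendsto' (hΛ _) (hΛ _) fun n => ?_
        exact integral_mono (hint n _) (hint n _) hfg }
  let M : Measure (StoneSpace A) := RealRMK.rieszMeasure Λ'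
  have hM : ∀ f : C(StoneSpace A, ℝ), ∫ x, f x ∂M = Λ f := fun f =>
    RealRMK.integral_rieszMeasure Λ' ⟨f, HasCompactSupport.of_compactSpace f⟩
  have hMa (a : A) : M.real (StoneSpace.basic a) = m a := by
    rw [← StoneSpace.integral_ind, hM]
    refine tendsto_nhds_unique (hΛ _) ?_
    simp_rw [StoneSpace.integral_ind]
    exact h a
  have hprob : IsProbabilityMeasure M := by
    have h1 := hMa ⊤
    rw [StoneSpace.basic_top, m.top'] at h1
    refine ⟨?_⟩
    rwa [Measure.real, ENNReal.toReal_eq_one_iff] at h1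
  refine ⟨⟨⟨M, hprob⟩, RealRMK.regular_rieszMeasure Λ'⟩, ?_, ?_⟩
  · exact FinAddProb.eq_of_apply_eq hMa
  · refine RadonProb.tendsto_iff_integral.2 fun f => ?_
    have := hΛ f.toContinuousMap
    rw [← hM] at this
    exact this

end Limit

/-! ### The sequential hierarchy -/

section Hierarchy

variable {K K' : Type*} [TopologicalSpace K] [MeasurableSpace K] [TopologicalSpace K']
  [MeasurableSpace K']

theorem mem_seqLevel_zero [OpensMeasurableSpace K] {D : Set K} {ν : RadonProb K} :
    ν ∈ seqLevel D 0 ↔ ν ∈ convDirac D := by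
  rw [seqLevel]
  simp

theorem mem_seqLevel_of_ne_zero [OpensMeasurableSpace K] {D : Set K} {α : Ordinal.{0}}
    (hα : α ≠ 0) {ν : RadonProb K} :
    ν ∈ seqLevel D α ↔ ∃ s : ℕ → RadonProb K,
      (∀ n, ∃ β < α, s n ∈ seqLevel D β) ∧ Tendsto s atTop (𝓝 ν) := by
  rw [seqLevel]
  simp [hα]

theorem mem_convDirac_iff [T2Space K] [BorelSpace K] {D : Set K} {ν : RadonProb K} :
    ν ∈ convDirac D ↔ ∃ t : Finset K, (t : Set K) ⊆ D ∧ ∀ᵐ x ∂(ν.1 : Measure K), x ∈ t := by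
  classical
  constructor
  · rintro ⟨t, w, ht, -, h⟩
    refine ⟨t, ht, ?_⟩
    rw [h, ae_finsetSum_measure_iff]
    intro i hi
    refine Measure.ae_smul_measure ?_ _
    exact (ae_dirac_iff t.measurableSet).2 hi
  · rintro ⟨t, ht, h⟩
    refine ⟨t, fun x => ν.1 {x}, ht, ?_, ?_⟩
    · have h1 : (ν.1 : Measure K) t = 1 := by
        rw [← prob_compl_eq_zero_iff t.measurableSet]
        exact h
      rw [← ENNReal.coe_inj]
      push_cast
      simp_rw [ProbabilityMeasure.ennreal_coeFn_eq_coeFn_toMeasure]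
      rw [sum_measure_singleton, h1]
    · rw [Measure.ae_mem_finset_iff] at h
      refine h.trans (Finset.sum_congr rfl fun x _ => ?_)
      rw [← ProbabilityMeasure.ennreal_coeFn_eq_coeFn_toMeasure]
      rfl

namespace RadonProb

variable [BorelSpace K] [T2Space K'] [BorelSpace K']

/-- The image under `f` of the conditional probability `ν(· | C)`, for `C` of positive measure. -/
noncomputable def condMap (ν : RadonProb K) (C : Set K) (hν : (ν.1 : Measure K) C ≠ 0)
    {f : K → K'} (hf : Continuous f) : RadonProb K' :=
  ⟨⟨(ProbabilityTheory.cond (ν.1 : Measure K) C).map f,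
      have := ProbabilityTheory.cond_isProbabilityMeasure hν
      Measure.isProbabilityMeasure_map hf.aemeasurable⟩, by
    have := ν.2
    have := ProbabilityTheory.cond_isProbabilityMeasure hν
    have h1 : (ProbabilityTheory.cond (ν.1 : Measure K) C).InnerRegularCompactLTTop := by
      unfold ProbabilityTheory.cond
      infer_instance
    have h2 := Measure.InnerRegularCompactLTTop.map_of_continuous
      (μ := ProbabilityTheory.cond (ν.1 : Measure K) C) hf
    change ((ProbabilityTheory.cond (ν.1 : Measure K) C).map f).Regular
    infer_instance⟩

variable {ν : RadonProb K} {C : Set K} {f : K → K'}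

theorem condMap_coe (hν : (ν.1 : Measure K) C ≠ 0) (hf : Continuous f) :
    ((ν.condMap C hν hf).1 : Measure K') = (ProbabilityTheory.cond (ν.1 : Measure K) C).map f :=
  rfl

theorem condMap_real (hC : IsClopen C) (hν : (ν.1 : Measure K) C ≠ 0) (hf : Continuous f)
    {S : Set K'} (hS : MeasurableSet S) :
    ((ν.condMap C hν hf).1 : Measure K').real S * (ν.1 : Measure K).real C =
      (ν.1 : Measure K).real (C ∩ f ⁻¹' S) := by
  rw [condMap_coe, map_measureReal_apply hf.measurable hS,
    Measure.real, ProbabilityTheory.cond_apply hC.isOpen.measurableSet, ENNReal.toReal_mul,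
    ENNReal.toReal_inv, ← Measure.real, ← Measure.real]
  have : (ν.1 : Measure K).real C ≠ 0 := by
    rw [Measure.real, ENNReal.toReal_ne_zero]
    exact ⟨hν, measure_ne_top _ _⟩
  field_simp

theorem condMap_mem_convDirac [T2Space K] (hν : (ν.1 : Measure K) C ≠ 0)
    (hf : Continuous f) {D : Set K} {D' : Set K'} (hD : Set.MapsTo f D D')
    (h : ν ∈ convDirac D) : ν.condMap C hν hf ∈ convDirac D' := by
  classical
  obtain ⟨t, ht, h⟩ := mem_convDirac_iff.1 h
  refine mem_convDirac_iff.2 ⟨t.image f, ?_, ?_⟩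
  · rw [Finset.coe_image]
    exact (hD.mono_left ht).image_subset
  · refine (ae_map_iff hf.aemeasurable (t.image f).measurableSet).2 ?_
    have := ProbabilityTheory.cond_absolutelyContinuous (μ := (ν.1 : Measure K)) (s := C)
    filter_upwards [this.ae_le h] with x hx
    exact Finset.mem_image_of_mem f hx

theorem tendsto_condMap (hC : IsClopen C) (hf : Continuous f) {s : ℕ → RadonProb K}
    (hs : Tendsto s atTop (𝓝 ν)) (hν : (ν.1 : Measure K) C ≠ 0)
    (hsC : ∀ n, ((s n).1 : Measure K) C ≠ 0) :
    Tendsto (fun n => (s n).condMap C (hsC n) hf) atTop (𝓝 (ν.condMap C hν hf)) := by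
  refine tendsto_iff_integral.2 fun g => ?_
  let g' : BoundedContinuousFunction K ℝ :=
    BoundedContinuousFunction.indicator C hC * g.compContinuous ⟨f, hf⟩
  have key (ρ : RadonProb K) (hρ : (ρ.1 : Measure K) C ≠ 0) :
      ∫ x, g x ∂((ρ.condMap C hρ hf).1 : Measure K') =
        ((ρ.1 : Measure K).real C)⁻¹ * ∫ x, g' x ∂(ρ.1 : Measure K) := by
    rw [condMap_coe, integral_map hf.aemeasurable
      g.continuous.aestronglyMeasurable, ProbabilityTheory.cond, integral_smul_measure,
      ENNReal.toReal_inv, smul_eq_mul, ← integral_indicator hC.isOpen.measurableSet]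
    congr 2
    ext x
    by_cases hx : x ∈ C <;> simp [g', hx]
  simp_rw [key]
  refine Tendsto.mul (Tendsto.inv₀ (tendsto_real_of_isClopen hs hC) ?_)
    (tendsto_iff_integral.1 hs g')
  rw [Measure.real, ENNReal.toReal_ne_zero]
  exact ⟨hν, measure_ne_top _ _⟩

/-- The sequential hierarchy is preserved by conditioning on a clopen set and by continuous
images. -/
theorem condMap_mem_seqLevel [T2Space K] (hC : IsClopen C) (hf : Continuous f)
    {D : Set K} {D' : Set K'} (hD : Set.MapsTo f D D') (α : Ordinal.{0}) {ν : RadonProb K} (hν : (ν.1 : Measure K) C ≠ 0)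
    (h : ν ∈ seqLevel D α) : ν.condMap C hν hf ∈ seqLevel D' α := by
  induction α using WellFoundedLT.induction generalizing ν with
  | ind α ih =>
    by_cases hα : α = 0
    · subst hα
      rw [mem_seqLevel_zero] at h ⊢
      exact condMap_mem_convDirac hν hf hD h
    · rw [mem_seqLevel_of_ne_zero hα] at h ⊢
      obtain ⟨s, hs, hlim⟩ := h
      have hpos : ∀ᶠ n in atTop, ((s n).1 : Measure K).real C ≠ 0 := by
        refine (tendsto_real_of_isClopen hlim hC).eventually_ne ?_
        rw [Measure.real, ENNReal.toReal_ne_zero]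
        exact ⟨hν, measure_ne_top _ _⟩
      obtain ⟨N, hN⟩ := eventually_atTop.1 hpos
      have hsN (n : ℕ) : ((s (n + N)).1 : Measure K) C ≠ 0 := fun h0 =>
        hN (n + N) (Nat.le_add_left _ _) (by simp [Measure.real, h0])
      refine ⟨fun n => (s (n + N)).condMap C (hsN n) hf, fun n => ?_, ?_⟩
      · obtain ⟨β, hβ, hsβ⟩ := hs (n + N)
        exact ⟨β, hβ, ih β hβ (hsN n) hsβ⟩
      · exact tendsto_condMap hC hf ((tendsto_add_atTop_iff_nat N).2 hlim) hν hsN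

end RadonProb

end Hierarchy

/-! ### Measures on Boolean algebras -/

theorem symmDiff_sup_sup_le {A : Type*} [BooleanAlgebra A] (a a' b b' : A) :
    symmDiff (a ⊔ b) (a' ⊔ b') ≤ symmDiff a a' ⊔ symmDiff b b' := by
  rw [symmDiff, symmDiff, symmDiff, sup_sdiff, sup_sdiff]
  refine sup_le (sup_le ?_ ?_) (sup_le ?_ ?_)
  · exact (sdiff_le_sdiff_left le_sup_left).trans (le_sup_left.trans le_sup_left)
  · exact (sdiff_le_sdiff_left le_sup_right).trans (le_sup_left.trans le_sup_right)
  · exact (sdiff_le_sdiff_left le_sup_left).trans (le_sup_right.trans le_sup_left)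
  · exact (sdiff_le_sdiff_left le_sup_right).trans (le_sup_right.trans le_sup_right)

namespace FinAddProb

variable {A : Type*} [BooleanAlgebra A] (m : FinAddProb A)

theorem apply_compl (a : A) : m aᶜ = 1 - m a := by
  have h := m.sup' a aᶜ disjoint_compl_right
  rw [sup_compl_eq_top, m.top'] at h
  linarith

theorem apply_symmDiff_le (a b c : A) :
    m (symmDiff a c) ≤ m (symmDiff a b) + m (symmDiff b c) :=
  (m.apply_mono (symmDiff_triangle a b c)).trans (m.apply_sup_le _ _)

theorem abs_apply_sub_le (a b : A) : |m a - m b| ≤ m (symmDiff a b) := by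
  have key : ∀ a b : A, m a ≤ m b + m (symmDiff a b) := fun a b => by
    have h1 : a ≤ b ⊔ symmDiff a b := by
      rw [sup_comm]
      exact le_symmDiff_sup_right a b
    linarith [m.apply_mono h1, m.apply_sup_le b (symmDiff a b)]
  have h1 := key a b
  have h2 := key b a
  rw [symmDiff_comm] at h2
  rw [abs_le]
  constructor <;> linarith

theorem apply_finset_sup_le {ι : Type*} (t : Finset ι) (f : ι → A) :
    m (t.sup f) ≤ ∑ i ∈ t, m (f i) := by
  classical
  induction t using Finset.induction_on with
  | empty => simp [m.apply_bot]
  | insert i t hi ih =>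
    rw [Finset.sup_insert, Finset.sum_insert hi]
    linarith [m.apply_sup_le (f i) (t.sup f)]

theorem cls_le_cls {a b : A} : m.cls a ≤ m.cls b ↔ m (a \ b) = 0 := by
  have h : m.cls a ≤ m.cls b ↔ m.cls (a ⊓ bᶜ) = m.cls ⊥ := disjoint_compl_right_iff.symm.trans
    disjoint_iff
  rw [h, cls_eq_cls, symmDiff_bot, sdiff_eq]

theorem quot_cls (a : A) : m.quot (m.cls a) = m a := rfl

theorem quot_eq_zero {x : m.NullQuot} : m.quot x = 0 ↔ x = ⊥ := by
  obtain ⟨a, rfl⟩ := m.cls_surj x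
  have h : m.cls a = ⊥ ↔ m.cls a = m.cls ⊥ := Iff.rfl
  rw [h, cls_eq_cls, symmDiff_bot, quot_cls]

namespace MetricIsoVia

variable {m} {C : Type*} [BooleanAlgebra C] {m' : FinAddProb C} {φ : A → C}

theorem apply_eq (h : MetricIsoVia m m' φ) (a : A) : m' (φ a) = m a := by
  obtain ⟨e, he⟩ := h
  rw [← (he a).2, (he a).1, quot_cls]

theorem map_compl (h : MetricIsoVia m m' φ) (a : A) : m' (symmDiff (φ a)ᶜ (φ aᶜ)) = 0 := by
  obtain ⟨e, he⟩ := h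
  rw [← cls_eq_cls, cls_compl, ← (he a).1, ← (he aᶜ).1]
  exact (map_compl' e a).symm

theorem map_sup (h : MetricIsoVia m m' φ) (a b : A) :
    m' (symmDiff (φ a ⊔ φ b) (φ (a ⊔ b))) = 0 := by
  obtain ⟨e, he⟩ := h
  rw [← cls_eq_cls, cls_sup, ← (he a).1, ← (he b).1, ← (he (a ⊔ b)).1, OrderIso.map_sup]
  rfl

theorem map_sdiff_of_le (h : MetricIsoVia m m' φ) {a b : A} (hab : a ≤ b) :
    m' (φ a \ φ b) = 0 := by
  obtain ⟨e, he⟩ := h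
  rw [← cls_le_cls, ← (he a).1, ← (he b).1]
  exact e.monotone hab

end MetricIsoVia

end FinAddProb

/-! ### The canonical algebra and its measure -/

/-- A sequence of sets that is a partition of `ℕ` into infinite sets. -/
structure IsInfinitePartition (B : ℕ → Set ℕ) : Prop where
  infinite : ∀ n, (B n).Infinite
  disjoint : Pairwise fun i j => Disjoint (B i) (B j)
  cover : ⋃ n, B n = Set.univ

/-- The set `{i | x_i ∈ A}`, where `x_0 < x_1 < ⋯` enumerates `b`. -/
def trace (b A : Set ℕ) : Set ℕ := {i | Nat.nth (· ∈ b) i ∈ A}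

theorem trace_inter_self {b : Set ℕ} (hb : b.Infinite) (A : Set ℕ) :
    trace b (A ∩ b) = trace b A := by
  ext i
  exact ⟨fun h => h.1, fun h => ⟨h, Nat.nth_mem_of_infinite hb i⟩⟩

theorem trace_copyIn {b : Set ℕ} (hb : b.Infinite) (A : Set ℕ) : trace b (copyIn b A) = A :=
  Set.preimage_image_eq A (Nat.nth_injective hb)

theorem copyIn_trace {b : Set ℕ} (hb : b.Infinite) (A : Set ℕ) :
    copyIn b (trace b A) = A ∩ b := by
  have h : Set.range (Nat.nth (· ∈ b)) = b := Nat.range_nth_of_infinite hb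
  conv_rhs => rw [← h]
  exact Set.image_preimage_eq_inter_range

theorem copyIn_subset {b : Set ℕ} (hb : b.Infinite) (A : Set ℕ) : copyIn b A ⊆ b := by
  rintro _ ⟨i, _, rfl⟩
  exact Nat.nth_mem_of_infinite hb i

theorem inter_mem_copyAlg {b : Set ℕ} (hb : b.Infinite) {𝔹 : BooleanSubalgebra (Set ℕ)}
    {A : Set ℕ} : A ∩ b ∈ copyAlg b 𝔹 ↔ trace b A ∈ 𝔹 := by
  constructor
  · rintro ⟨T, hT, h⟩
    rw [← trace_inter_self hb, ← h, trace_copyIn hb]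
    exact hT
  · intro h
    exact ⟨_, h, copyIn_trace hb A⟩

theorem copyMeasure_inter {b : Set ℕ} (hb : b.Infinite) {𝔹 : BooleanSubalgebra (Set ℕ)}
    (m : FinAddProb 𝔹) {A : Set ℕ} (h : trace b A ∈ 𝔹) :
    copyMeasure b m (A ∩ b) = m ⟨trace b A, h⟩ := by
  have h1 := trace_inter_self hb A
  have h2 : {i | Nat.nth (· ∈ b) i ∈ A ∩ b} ∈ 𝔹 := by
    change trace b (A ∩ b) ∈ 𝔹
    rwa [h1]
  rw [copyMeasure, dif_pos h2]
  congr 1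
  exact Subtype.ext h1

theorem IsInfinitePartition.trace_iUnion_copyIn {B : ℕ → Set ℕ} (hB : IsInfinitePartition B)
    (T : ℕ → Set ℕ) (n : ℕ) : trace (B n) (⋃ k, copyIn (B k) (T k)) = T n := by
  conv_rhs => rw [← trace_copyIn (hB.infinite n) (T n)]
  ext i
  refine ⟨fun h => ?_, fun h => Set.mem_iUnion.2 ⟨n, h⟩⟩
  obtain ⟨k, hk⟩ := Set.mem_iUnion.1 h
  obtain rfl : k = n := by
    by_contra hkn
    exact Set.disjoint_left.1 (hB.disjoint hkn) (copyIn_subset (hB.infinite k) _ hk)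
      (Nat.nth_mem_of_infinite (hB.infinite n) i)
  exact hk

theorem IsInfinitePartition.subset_of_trace {B : ℕ → Set ℕ} (hB : IsInfinitePartition B)
    {A A' : Set ℕ} (h : ∀ n, trace (B n) A ⊆ trace (B n) A') : A ⊆ A' := by
  intro x hx
  have h1 : x ∈ ⋃ n, B n := by
    rw [hB.cover]
    exact Set.mem_univ x
  obtain ⟨n, hn⟩ := Set.mem_iUnion.1 h1
  have h2 : x ∈ copyIn (B n) (trace (B n) A) := by
    rw [copyIn_trace (hB.infinite n)]
    exact ⟨hx, hn⟩
  obtain ⟨i, hi, rfl⟩ := h2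
  exact h n hi

section AsympRep

variable {𝔹 : ℕ → BooleanSubalgebra (Set ℕ)} {μ : ∀ n, FinAddProb (𝔹 n)}
  {L : Type*} {φ : ∀ n, L → 𝔹 n}

/-- The sequence `T n ∈ 𝔹 n` represents `M` asymptotically: the distance of `T n` and `φ n M`
tends to zero. -/
def AsympRep (μ : ∀ n, FinAddProb (𝔹 n)) (φ : ∀ n, L → 𝔹 n) (T : ∀ n, 𝔹 n)
    (M : L) : Prop :=
  Tendsto (fun n => μ n (symmDiff (T n) (φ n M))) atTop (𝓝 0)

namespace AsympRep

variable {T T' : ∀ n, 𝔹 n} {M M' : L}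

theorem of_le {u : ℕ → ℝ} (hu : Tendsto u atTop (𝓝 0))
    (h : ∀ n, μ n (symmDiff (T n) (φ n M)) ≤ u n) : AsympRep μ φ T M :=
  squeeze_zero (fun n => (μ n).nonneg' _) h hu

theorem self (M : L) : AsympRep μ φ (fun n => φ n M) M := by
  refine of_le (u := fun _ => 0) tendsto_const_nhds fun n => ?_
  rw [symmDiff_self, (μ n).apply_bot]

variable [BooleanAlgebra L] {l : FinAddProb L}

theorem compl (hφ : ∀ n, FinAddProb.MetricIsoVia l (μ n) (φ n))
    (h : AsympRep μ φ T M) : AsympRep μ φ (fun n => (T n)ᶜ) Mᶜ := by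
  refine of_le h fun n => ((μ n).apply_symmDiff_le _ (φ n M)ᶜ _).trans ?_
  rw [(hφ n).map_compl, compl_symmDiff_compl, add_zero]

theorem sup (hφ : ∀ n, FinAddProb.MetricIsoVia l (μ n) (φ n))
    (h : AsympRep μ φ T M) (h' : AsympRep μ φ T' M') :
    AsympRep μ φ (fun n => T n ⊔ T' n) (M ⊔ M') := by
  refine of_le (by simpa using Tendsto.add h h') fun n =>
    ((μ n).apply_symmDiff_le _ (φ n M ⊔ φ n M') _).trans ?_
  rw [(hφ n).map_sup, add_zero]
  exact ((μ n).apply_mono (symmDiff_sup_sup_le _ _ _ _)).trans ((μ n).apply_sup_le _ _)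

theorem sdiff (hφ : ∀ n, FinAddProb.MetricIsoVia l (μ n) (φ n))
    (h : AsympRep μ φ T M) (h' : AsympRep μ φ T' M') :
    AsympRep μ φ (fun n => T n \ T' n) (M \ M') := by
  have := ((h.compl hφ).sup hφ h').compl hφ
  simpa [sdiff_eq, compl_sup] using this

theorem tendsto (hφ : ∀ n, FinAddProb.MetricIsoVia l (μ n) (φ n))
    (h : AsympRep μ φ T M) :
    Tendsto (fun n => μ n (T n)) atTop (𝓝 (l M)) := by
  rw [tendsto_iff_dist_tendsto_zero]
  refine squeeze_zero (fun n => dist_nonneg) (fun n => ?_) h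
  rw [← (hφ n).apply_eq M]
  exact (μ n).abs_apply_sub_le _ _

end AsympRep

end AsympRep

section Canonical

variable {B : ℕ → Set ℕ} {𝔹 : ℕ → BooleanSubalgebra (Set ℕ)} {μ : ∀ n, FinAddProb (𝔹 n)}
  {φ : ∀ n, LebesgueAlgebra → 𝔹 n}

/-- The members of the canonical algebra are the sets whose traces on the blocks represent some
`M` asymptotically. -/
theorem mem_canonicalAlgebra_iff (hB : IsInfinitePartition B)
    (hφ : ∀ n, FinAddProb.MetricIsoVia lebesgueAlgebraMeasure (μ n) (φ n)) {A : Set ℕ} :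
    A ∈ canonicalAlgebra B 𝔹 μ φ ↔
      ∃ T : ∀ n, 𝔹 n, (∀ n, (T n : Set ℕ) = trace (B n) A) ∧ ∃ M, AsympRep μ φ T M := by
  constructor
  · intro h
    induction h using BooleanSubalgebra.closure_bot_sup_induction with
    | mem A hA =>
      rcases hA with ⟨hA, hlim⟩ | ⟨M, rfl⟩
      · have hA' (n) : trace (B n) A ∈ 𝔹 n := (inter_mem_copyAlg (hB.infinite n)).1 (hA n)
        refine ⟨fun n => ⟨_, hA' n⟩, fun n => rfl, ⊤, ?_⟩
        -- both `A` and `φ n ⊤` are asymptotically of full measure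
        have h1 : Tendsto (fun n => 1 - copyMeasure (B n) (μ n) (A ∩ B n)) atTop (𝓝 0) := by
          simpa using hlim.const_sub 1
        refine AsympRep.of_le h1 fun n => ?_
        rw [copyMeasure_inter (hB.infinite n) (μ n) (hA' n), ← (μ n).apply_compl]
        have h2 : (μ n) (φ n ⊤)ᶜ = 0 := by
          rw [(μ n).apply_compl, (hφ n).apply_eq]
          rw [lebesgueAlgebraMeasure.top', sub_self]
        rw [← compl_symmDiff_compl]
        refine ((μ n).apply_mono symmDiff_le_sup).trans (((μ n).apply_sup_le _ _).trans ?_)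
        rw [h2, add_zero]
      · exact ⟨fun n => φ n M, fun n => (hB.trace_iUnion_copyIn (fun n => (φ n M : Set ℕ)) n).symm,
          M, AsympRep.self M⟩
    | bot =>
      exact ⟨fun n => ⊥, fun n => rfl, ⊤ᶜ, by
        have := ((AsympRep.self (μ := μ) (φ := φ) ⊤).sdiff hφ (AsympRep.self ⊤))
        simpa using this⟩
    | sup A hA A' hA' ih ih' =>
      obtain ⟨T, hT, M, hM⟩ := ih
      obtain ⟨T', hT', M', hM'⟩ := ih'
      refine ⟨fun n => T n ⊔ T' n, fun n => ?_, _, hM.sup hφ hM'⟩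
      rw [BooleanSubalgebra.val_sup, hT, hT']
      rfl
    | compl A hA ih =>
      obtain ⟨T, hT, M, hM⟩ := ih
      refine ⟨fun n => (T n)ᶜ, fun n => ?_, _, hM.compl hφ⟩
      rw [BooleanSubalgebra.val_compl, hT]
      rfl
  · rintro ⟨T, hT, M, hM⟩
    -- `A` differs from the generator given by `M` by a set `Z` whose complement is a generator
    set Z : Set ℕ := symmDiff A (⋃ n, copyIn (B n) (φ n M : Set ℕ)) with hZ
    have hZt (n) : trace (B n) Zᶜ = ((symmDiff (T n) (φ n M))ᶜ : 𝔹 n) := by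
      have h1 := hB.trace_iUnion_copyIn (fun n => (φ n M : Set ℕ)) n
      have h2 : trace (B n) Zᶜ = (symmDiff (trace (B n) A)
        (trace (B n) (⋃ n, copyIn (B n) (φ n M : Set ℕ))))ᶜ := rfl
      rw [h2, h1, ← hT]
      rfl
    have hZmem : Zᶜ ∈ canonicalAlgebra B 𝔹 μ φ := by
      have hZ𝔹 (n) : trace (B n) Zᶜ ∈ 𝔹 n := by
        rw [hZt]
        exact Subtype.property _
      refine BooleanSubalgebra.subset_closure (Or.inl
        ⟨fun n => (inter_mem_copyAlg (hB.infinite n)).2 (hZ𝔹 n), ?_⟩)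
      have h1 : Tendsto (fun n => 1 - μ n (symmDiff (T n) (φ n M))) atTop (𝓝 1) := by
        simpa using Tendsto.const_sub 1 hM
      refine h1.congr fun n => ?_
      rw [copyMeasure_inter (hB.infinite n) (μ n) (hZ𝔹 n), ← (μ n).apply_compl]
      congr 1
      exact Subtype.ext (hZt n).symm
    have hG : (⋃ n, copyIn (B n) (φ n M : Set ℕ)) ∈ canonicalAlgebra B 𝔹 μ φ :=
      BooleanSubalgebra.subset_closure (Or.inr ⟨M, rfl⟩)
    have hZ' := BooleanSubalgebra.compl_mem hZmem
    rw [compl_compl] at hZ'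
    have hA : A = symmDiff Z (⋃ n, copyIn (B n) (φ n M : Set ℕ)) := by
      rw [hZ, symmDiff_symmDiff_cancel_right]
    rw [hA]
    exact BooleanSubalgebra.sup_mem (BooleanSubalgebra.sdiff_mem hZ' hG)
      (BooleanSubalgebra.sdiff_mem hG hZ')

theorem trace_mem (hB : IsInfinitePartition B)
    (hφ : ∀ n, FinAddProb.MetricIsoVia lebesgueAlgebraMeasure (μ n) (φ n)) (n : ℕ)
    (A : canonicalAlgebra B 𝔹 μ φ) : trace (B n) A ∈ 𝔹 n := by
  obtain ⟨T, hT, -⟩ := (mem_canonicalAlgebra_iff hB hφ).1 A.2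
  rw [← hT n]
  exact (T n).2

/-- The homomorphism `A ↦ {i | x^n_i ∈ A}` from the canonical algebra to `𝔹 n`. -/
def traceHom (hB : IsInfinitePartition B)
    (hφ : ∀ n, FinAddProb.MetricIsoVia lebesgueAlgebraMeasure (μ n) (φ n)) (n : ℕ) :
    BoundedLatticeHom (canonicalAlgebra B 𝔹 μ φ) (𝔹 n) where
  toFun A := ⟨trace (B n) A, trace_mem hB hφ n A⟩
  map_sup' _ _ := rfl
  map_inf' _ _ := rfl
  map_top' := rfl
  map_bot' := rfl

/-- The set whose trace on the `n`-th block is `T n`, provided that `T` represents some `M`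
asymptotically. -/
def glue (hB : IsInfinitePartition B)
    (hφ : ∀ n, FinAddProb.MetricIsoVia lebesgueAlgebraMeasure (μ n) (φ n)) (T : ∀ n, 𝔹 n)
    (hT : ∃ M, AsympRep μ φ T M) : canonicalAlgebra B 𝔹 μ φ :=
  ⟨⋃ n, copyIn (B n) (T n : Set ℕ), (mem_canonicalAlgebra_iff hB hφ).2
    ⟨T, fun n => (hB.trace_iUnion_copyIn (fun n => (T n : Set ℕ)) n).symm, hT⟩⟩

variable (hB : IsInfinitePartition B)
  (hφ : ∀ n, FinAddProb.MetricIsoVia lebesgueAlgebraMeasure (μ n) (φ n))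

theorem traceHom_glue (T : ∀ n, 𝔹 n) (hT : ∃ M, AsympRep μ φ T M) (n : ℕ) :
    traceHom hB hφ n (glue hB hφ T hT) = T n :=
  Subtype.ext (hB.trace_iUnion_copyIn (fun n => (T n : Set ℕ)) n)

theorem le_of_traceHom_le {A A' : canonicalAlgebra B 𝔹 μ φ}
    (h : ∀ n, traceHom hB hφ n A ≤ traceHom hB hφ n A') : A ≤ A' :=
  hB.subset_of_trace h

theorem exists_asympRep (A : canonicalAlgebra B 𝔹 μ φ) :
    ∃ M, AsympRep μ φ (fun n => traceHom hB hφ n A) M := by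
  obtain ⟨T, hT, M, hM⟩ := (mem_canonicalAlgebra_iff hB hφ).1 A.2
  refine ⟨M, ?_⟩
  have : T = fun n => traceHom hB hφ n A := funext fun n => Subtype.ext (hT n)
  rwa [← this]

theorem tendsto_choose_asympRep (A : canonicalAlgebra B 𝔹 μ φ) :
    Tendsto (fun n => μ n (traceHom hB hφ n A)) atTop
      (𝓝 (lebesgueAlgebraMeasure (exists_asympRep hB hφ A).choose)) :=
  (exists_asympRep hB hφ A).choose_spec.tendsto hφ

/-- The limit measure on the canonical algebra; its value at `A` is the Lebesgue measure of an
element that `A` represents asymptotically. -/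
noncomputable def canonicalMeasure : FinAddProb (canonicalAlgebra B 𝔹 μ φ) where
  toFun A := lebesgueAlgebraMeasure (exists_asympRep hB hφ A).choose
  nonneg' A := lebesgueAlgebraMeasure.nonneg' _
  top' := by
    refine tendsto_nhds_unique (tendsto_choose_asympRep hB hφ ⊤) ?_
    refine tendsto_const_nhds.congr fun n => ?_
    exact (μ n).top'.symm
  sup' A A' h := by
    refine tendsto_nhds_unique (tendsto_choose_asympRep hB hφ _) ?_
    refine ((tendsto_choose_asympRep hB hφ A).add (tendsto_choose_asympRep hB hφ A')).congr
      fun n => ?_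
    exact ((μ n).sup' _ _ (h.map (traceHom hB hφ n))).symm

theorem tendsto_canonicalMeasure (A : canonicalAlgebra B 𝔹 μ φ) :
    Tendsto (fun n => μ n (traceHom hB hφ n A)) atTop (𝓝 (canonicalMeasure hB hφ A)) :=
  tendsto_choose_asympRep hB hφ A

theorem canonicalMeasure_eq {A : canonicalAlgebra B 𝔹 μ φ} {M : LebesgueAlgebra}
    (h : AsympRep μ φ (fun n => traceHom hB hφ n A) M) :
    canonicalMeasure hB hφ A = lebesgueAlgebraMeasure M :=
  tendsto_nhds_unique (tendsto_canonicalMeasure hB hφ A) (h.tendsto hφ)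

theorem canonicalMeasure_glue (T : ∀ n, 𝔹 n) {M : LebesgueAlgebra} (hT : AsympRep μ φ T M) :
    canonicalMeasure hB hφ (glue hB hφ T ⟨M, hT⟩) = lebesgueAlgebraMeasure M := by
  refine canonicalMeasure_eq hB hφ ?_
  simp_rw [traceHom_glue]
  exact hT

theorem isCanonicalMeasure_canonicalMeasure :
    IsCanonicalMeasure B 𝔹 μ φ (canonicalMeasure hB hφ) := by
  intro A
  refine ⟨fun n => (inter_mem_copyAlg (hB.infinite n)).2 (trace_mem hB hφ n A),
    (tendsto_canonicalMeasure hB hφ A).congr fun n => ?_⟩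
  rw [copyMeasure_inter (hB.infinite n) (μ n) (trace_mem hB hφ n A)]
  rfl

/-- The map `M ↦ ⋃_n φ_n(M)^n`. -/
def canonicalMap (M : LebesgueAlgebra) : canonicalAlgebra B 𝔹 μ φ :=
  glue hB hφ (fun n => φ n M) ⟨M, AsympRep.self M⟩

theorem metricIsoVia_canonicalMap :
    FinAddProb.MetricIsoVia lebesgueAlgebraMeasure (canonicalMeasure hB hφ)
      (canonicalMap hB hφ) := by
  have hle (M N : LebesgueAlgebra) : (canonicalMeasure hB hφ).cls (canonicalMap hB hφ M) ≤
      (canonicalMeasure hB hφ).cls (canonicalMap hB hφ N) ↔ M ≤ N := by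
    have h1 : canonicalMeasure hB hφ (canonicalMap hB hφ M \ canonicalMap hB hφ N) =
        lebesgueAlgebraMeasure (M \ N) := by
      refine canonicalMeasure_eq hB hφ ?_
      simp_rw [map_sdiff', canonicalMap, traceHom_glue]
      exact (AsympRep.self M).sdiff hφ (AsympRep.self N)
    rw [FinAddProb.cls_le_cls, h1, ← sdiff_eq_bot_iff]
    exact borelLebesgue.quot_eq_zero
  have hsurj : Function.Surjective fun M : LebesgueAlgebra =>
      (canonicalMeasure hB hφ).cls (canonicalMap hB hφ M) := by
    intro x
    obtain ⟨A, rfl⟩ := (canonicalMeasure hB hφ).cls_surj x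
    obtain ⟨M, hM⟩ := exists_asympRep hB hφ A
    refine ⟨M, ((canonicalMeasure hB hφ).cls_eq_cls).2 ?_⟩
    refine tendsto_nhds_unique (tendsto_canonicalMeasure hB hφ _) (Tendsto.congr (fun n => ?_) hM)
    rw [map_symmDiff', canonicalMap, traceHom_glue, symmDiff_comm]
  refine ⟨RelIso.ofSurjective (OrderEmbedding.ofMapLEIff _ hle) hsurj, fun M => ⟨rfl, ?_⟩⟩
  exact canonicalMeasure_glue hB hφ _ (AsympRep.self M)

end Canonical

/-! ### The level of the canonical measure -/

theorem RadonProb.toFinAddProb_condMap {A A' : Type*} [BooleanAlgebra A] [BooleanAlgebra A']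
    (ν : RadonProb (StoneSpace A')) (c : A')
    (hν : (ν.1 : Measure (StoneSpace A')) (StoneSpace.basic c) ≠ 0) (f : BoundedLatticeHom A A')
    (a : A) :
    RadonProb.toFinAddProb (ν.condMap _ hν (StoneSpace.continuous_comap f)) a *
      RadonProb.toFinAddProb ν c = RadonProb.toFinAddProb ν (c ⊓ f a) := by
  have h := RadonProb.condMap_real (StoneSpace.isClopen_basic c) hν (StoneSpace.continuous_comap f)
    (StoneSpace.isOpen_basic a).measurableSet
  rw [StoneSpace.comap_preimage_basic, ← StoneSpace.basic_inf] at h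
  exact h

section Canonical

variable {B : ℕ → Set ℕ} {𝔹 : ℕ → BooleanSubalgebra (Set ℕ)} {μ : ∀ n, FinAddProb (𝔹 n)}
  {φ : ∀ n, LebesgueAlgebra → 𝔹 n} (hB : IsInfinitePartition B)
  (hφ : ∀ n, FinAddProb.MetricIsoVia lebesgueAlgebraMeasure (μ n) (φ n))

/-- The canonical measure is the weak limit of the images of the measures `μ n` under the
embeddings of the Stone spaces of `𝔹 n` dual to `traceHom`. -/
theorem memLevel_canonicalMeasure {γ : Ordinal.{0}} (h : ∀ n, ∃ β < γ, (μ n).MemLevel β) :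
    (canonicalMeasure hB hφ).MemLevel γ := by
  have hγ : γ ≠ 0 := by
    obtain ⟨β, hβ, -⟩ := h 0
    exact hβ.ne_bot
  choose β hβ ν hν hνμ using h
  have hpos (n : ℕ) : ((ν n).1 : Measure (StoneSpace (𝔹 n))) (StoneSpace.basic ⊤) ≠ 0 := by
    rw [StoneSpace.basic_top, measure_univ]
    exact one_ne_zero
  let s (n : ℕ) : RadonProb (StoneSpace (canonicalAlgebra B 𝔹 μ φ)) :=
    (ν n).condMap _ (hpos n) (StoneSpace.continuous_comap (traceHom hB hφ n))
  have hs (n : ℕ) : s n ∈ seqLevel (Set.range (StoneSpace.principal (canonicalAlgebra B 𝔹 μ φ)))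
      (β n) := by
    refine RadonProb.condMap_mem_seqLevel (StoneSpace.isClopen_basic _) _ ?_ _ _ (hν n)
    rintro _ ⟨i, rfl⟩
    exact ⟨Nat.nth (· ∈ B n) i, rfl⟩
  have hval (n : ℕ) (A : canonicalAlgebra B 𝔹 μ φ) :
      RadonProb.toFinAddProb (s n) A = μ n (traceHom hB hφ n A) := by
    have h1 := RadonProb.toFinAddProb_condMap (ν n) ⊤ (hpos n) (traceHom hB hφ n) A
    rwa [top_inf_eq, (RadonProb.toFinAddProb (ν n)).top', mul_one, hνμ] at h1
  obtain ⟨ρ, hρ, hlim⟩ := exists_radonProb_tendsto s (canonicalMeasure hB hφ) fun A => by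
    simp_rw [hval]
    exact tendsto_canonicalMeasure hB hφ A
  exact ⟨ρ, (mem_seqLevel_of_ne_zero hγ).2 ⟨s, fun n => ⟨β n, hβ n, hs n⟩, hlim⟩, hρ⟩

/-! ### Blocks -/

/-- A set with traces in the given algebras is in the canonical algebra if its traces are
eventually trivial. -/
theorem mem_canonicalAlgebra_of_eventually (hB : IsInfinitePartition B)
    (hφ : ∀ n, FinAddProb.MetricIsoVia lebesgueAlgebraMeasure (μ n) (φ n)) {A : Set ℕ}
    (hA : ∀ n, trace (B n) A ∈ 𝔹 n)
    (h : (∀ᶠ n in atTop, trace (B n) A = ∅) ∨ ∀ᶠ n in atTop, trace (B n) A = Set.univ) :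
    A ∈ canonicalAlgebra B 𝔹 μ φ := by
  refine (mem_canonicalAlgebra_iff hB hφ).2 ⟨fun n => ⟨_, hA n⟩, fun n => rfl, ?_⟩
  rcases h with h | h
  · refine ⟨⊥, Tendsto.congr' ?_ ((AsympRep.self ⊤).sdiff hφ (AsympRep.self ⊤) :
      AsympRep μ φ _ _)⟩
    filter_upwards [h] with n hn
    have : (⟨trace (B n) A, hA n⟩ : 𝔹 n) = ⊥ := Subtype.ext hn
    rw [this, sdiff_self, sdiff_self]
  · refine ⟨⊤, Tendsto.congr' ?_ (((AsympRep.self ⊤).sdiff hφ (AsympRep.self ⊤)).compl hφ :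
      AsympRep μ φ _ _)⟩
    filter_upwards [h] with n hn
    have : (⟨trace (B n) A, hA n⟩ : 𝔹 n) = ⊤ := Subtype.ext hn
    rw [this, sdiff_self, sdiff_self, compl_bot, compl_bot]

theorem IsInfinitePartition.nth_notMem {B : ℕ → Set ℕ} (hB : IsInfinitePartition B) {n k : ℕ}
    (h : k ≠ n) (i : ℕ) : Nat.nth (· ∈ B k) i ∉ B n :=
  Set.disjoint_left.1 (hB.disjoint h) (Nat.nth_mem_of_infinite (hB.infinite k) i)

theorem IsInfinitePartition.trace_self {B : ℕ → Set ℕ} (hB : IsInfinitePartition B) (n : ℕ) :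
    trace (B n) (B n) = Set.univ :=
  Set.eq_univ_of_forall fun i => Nat.nth_mem_of_infinite (hB.infinite n) i

theorem IsInfinitePartition.trace_of_ne {B : ℕ → Set ℕ} (hB : IsInfinitePartition B) {n k : ℕ}
    (h : k ≠ n) : trace (B k) (B n) = ∅ :=
  Set.eq_empty_of_forall_notMem fun i => hB.nth_notMem h i

/-- The `n`-th block as a member of the canonical algebra. -/
def block (n : ℕ) : canonicalAlgebra B 𝔹 μ φ :=
  ⟨B n, mem_canonicalAlgebra_of_eventually hB hφ
    (fun k => by
      by_cases h : k = n
      · subst h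
        rw [hB.trace_self]
        exact BooleanSubalgebra.top_mem
      · rw [hB.trace_of_ne h]
        exact BooleanSubalgebra.bot_mem)
    (Or.inl ((eventually_gt_atTop n).mono fun k hk => hB.trace_of_ne hk.ne'))⟩

theorem traceHom_block (n : ℕ) : traceHom hB hφ n (block hB hφ n) = ⊤ :=
  Subtype.ext (hB.trace_self n)

theorem disjoint_block {n k : ℕ} (h : n ≠ k) : Disjoint (block hB hφ n) (block hB hφ k) := by
  rw [disjoint_iff]
  exact Subtype.ext (hB.disjoint h).eq_bot

open scoped Classical in
/-- The position in `b`: the `i`-th element of `b` is sent to `i`, the numbers outside of `b`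
to `0`. -/
noncomputable def blockIndex (b : Set ℕ) (x : ℕ) : ℕ := if x ∈ b then Nat.count (· ∈ b) x else 0

theorem blockIndex_nth {b : Set ℕ} (hb : b.Infinite) (i : ℕ) :
    blockIndex b (Nat.nth (· ∈ b) i) = i := by
  classical
  have h : Nat.nth (· ∈ b) i ∈ b := Nat.nth_mem_of_infinite hb i
  rw [blockIndex, if_pos h]
  exact Nat.count_nth_of_infinite (p := (· ∈ b)) hb i

/-- The homomorphism `𝔹 n → 𝔹` whose dual maps the clopen set of the `n`-th block onto the Stone
space of `𝔹 n`, and the complement of that set to the principal ultrafilter of `0`. -/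
noncomputable def blockHom (n : ℕ) : BoundedLatticeHom (𝔹 n) (canonicalAlgebra B 𝔹 μ φ) where
  toFun A := ⟨blockIndex (B n) ⁻¹' A, by
    have h1 : trace (B n) (blockIndex (B n) ⁻¹' A) = A := by
      ext i
      change blockIndex (B n) (Nat.nth (· ∈ B n) i) ∈ (A : Set ℕ) ↔ _
      rw [blockIndex_nth (hB.infinite n)]
    have h2 (k : ℕ) (hk : k ≠ n) :
        trace (B k) (blockIndex (B n) ⁻¹' A) = {_i | 0 ∈ (A : Set ℕ)} := by
      ext i
      change blockIndex (B n) (Nat.nth (· ∈ B k) i) ∈ (A : Set ℕ) ↔ _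
      rw [blockIndex, if_neg (hB.nth_notMem hk i)]
      rfl
    refine mem_canonicalAlgebra_of_eventually hB hφ (fun k => ?_) ?_
    · by_cases hk : k = n
      · subst hk
        rw [h1]
        exact A.2
      · rw [h2 k hk]
        by_cases h0 : 0 ∈ (A : Set ℕ)
        · simpa [h0] using (BooleanSubalgebra.top_mem : ⊤ ∈ 𝔹 k)
        · simpa [h0] using (BooleanSubalgebra.bot_mem : ⊥ ∈ 𝔹 k)
    · by_cases h0 : 0 ∈ (A : Set ℕ)
      · refine Or.inr ((eventually_gt_atTop n).mono fun k hk => ?_)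
        simp [h2 k hk.ne', h0]
      · refine Or.inl ((eventually_gt_atTop n).mono fun k hk => ?_)
        simp [h2 k hk.ne', h0]⟩
  map_sup' _ _ := rfl
  map_inf' _ _ := rfl
  map_top' := rfl
  map_bot' := rfl

theorem le_block_inf_blockHom {n : ℕ} {A : canonicalAlgebra B 𝔹 μ φ} {E : 𝔹 n}
    (hA : A ≤ block hB hφ n) (hE : traceHom hB hφ n A ≤ E) :
    A ≤ block hB hφ n ⊓ blockHom hB hφ n E := by
  refine le_inf hA fun x hx => ?_
  obtain ⟨i, rfl⟩ : x ∈ Set.range (Nat.nth (· ∈ B n)) := by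
    exact (Nat.range_nth_of_infinite (p := (· ∈ B n)) (hB.infinite n)).ge (hA hx)
  change blockIndex (B n) (Nat.nth (· ∈ B n) i) ∈ (E : Set ℕ)
  rw [blockIndex_nth (hB.infinite n)]
  exact hE hx

/-- Orthogonality of `μ n` passes to the part of a Radon measure that lives on the `n`-th block. -/
theorem exists_small_on_block {n : ℕ} {γ : Ordinal.{0}} (h : (μ n).OrthogonalToLevel γ)
    {ν : RadonProb (StoneSpace (canonicalAlgebra B 𝔹 μ φ))} (hν : ν ∈ seqLevel Set.univ γ)
    {η : ℝ} (hη : 0 < η) :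
    ∃ E : 𝔹 n, 1 - η < μ n E ∧ ∀ A ≤ block hB hφ n, traceHom hB hφ n A ≤ E →
      RadonProb.toFinAddProb ν A < η := by
  by_cases h0 : (ν.1 : Measure (StoneSpace (canonicalAlgebra B 𝔹 μ φ)))
      (StoneSpace.basic (block hB hφ n)) = 0
  · refine ⟨⊤, ?_, fun A hA _ => ?_⟩
    · rw [(μ n).top']
      linarith
    · refine ((RadonProb.toFinAddProb ν).apply_mono hA).trans_lt ?_
      change (ν.1 : Measure (StoneSpace (canonicalAlgebra B 𝔹 μ φ))).real _ < η
      rwa [Measure.real, h0]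
  · obtain ⟨E, hE, hE'⟩ := h _ (RadonProb.condMap_mem_seqLevel (StoneSpace.isClopen_basic _)
      (StoneSpace.continuous_comap (blockHom hB hφ n)) (Set.mapsTo_univ _ _) γ h0 hν) η hη
    refine ⟨E, hE, fun A hA hAE => ?_⟩
    refine ((RadonProb.toFinAddProb ν).apply_mono
      (le_block_inf_blockHom hB hφ hA hAE)).trans_lt ?_
    rw [← RadonProb.toFinAddProb_condMap ν _ h0]
    refine lt_of_le_of_lt (mul_le_of_le_one_right (FinAddProb.nonneg' _ _) ?_) hE'
    exact ((RadonProb.toFinAddProb ν).apply_mono le_top).trans (RadonProb.toFinAddProb ν).top'.le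

end Canonical

/-! ### Orthogonality to finite combinations of Dirac measures -/

theorem borelLebesgue_Icc_le (x y : ℝ) (h : x ≤ y) :
    borelLebesgue ⟨{t : unitInterval | (t : ℝ) ∈ Set.Icc x y},
      measurableSet_Icc.preimage measurable_subtype_coe⟩ ≤ y - x := by
  change (volume : Measure unitInterval).real
    ((fun t : unitInterval => (t : ℝ)) ⁻¹' Set.Icc x y) ≤ _
  rw [Measure.real, Measure.Subtype.volume_def, Measure.comap_apply _ Subtype.val_injective
    (fun s hs => (MeasurableEmbedding.subtype_coe measurableSet_Icc).measurableSet_image.2 hs) _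
    (measurableSet_Icc.preimage measurable_subtype_coe)]
  refine (ENNReal.toReal_mono ?_ (measure_mono (Set.image_preimage_subset _ _))).trans ?_
  · simp
  · simp [h]

/-- The Lebesgue algebra has finite partitions of unity into elements of small measure. -/
theorem exists_finset_sup_eq_top {ε : ℝ} (hε : 0 < ε) :
    ∃ (t : Finset ℕ) (M : ℕ → LebesgueAlgebra), t.sup M = ⊤ ∧
      ∀ i, lebesgueAlgebraMeasure (M i) < ε := by
  obtain ⟨p, hp⟩ := exists_nat_one_div_lt hε
  let s (i : ℕ) : {s : Set unitInterval // MeasurableSet s} :=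
    ⟨{t : unitInterval | (t : ℝ) ∈ Set.Icc ((i : ℝ) / (p + 1)) ((i + 1 : ℝ) / (p + 1))},
      measurableSet_Icc.preimage measurable_subtype_coe⟩
  have hs (i : ℕ) : borelLebesgue (s i) < ε := by
    refine (borelLebesgue_Icc_le _ _ (by gcongr; simp)).trans_lt ?_
    rwa [← sub_div, add_sub_cancel_left]
  refine ⟨Finset.range (p + 2), fun i => borelLebesgue.cls (s i), ?_, hs⟩
  have h1 : (Finset.range (p + 2)).sup s = ⊤ := by
    refine top_le_iff.1 fun x _ => ?_
    have hp0 : (0 : ℝ) < p + 1 := by positivity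
    have hx0 : 0 ≤ (x : ℝ) * (p + 1) := mul_nonneg x.2.1 hp0.le
    have hi : ⌊(x : ℝ) * (p + 1)⌋₊ ∈ Finset.range (p + 2) := by
      rw [Finset.mem_range, Nat.floor_lt hx0]
      push_cast
      nlinarith [x.2.2]
    have hle : s ⌊(x : ℝ) * (p + 1)⌋₊ ≤ (Finset.range (p + 2)).sup s := Finset.le_sup hi
    refine hle ?_
    change (x : ℝ) ∈ Set.Icc _ _
    rw [Set.mem_Icc, div_le_iff₀ hp0, le_div_iff₀ hp0]
    exact ⟨Nat.floor_le hx0, (Nat.lt_floor_add_one _).le⟩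
  have h2 := Finset.apply_sup_eq_sup_comp (s := Finset.range (p + 2)) (f := s) borelLebesgue.cls
    (fun _ _ => rfl) rfl
  rw [h1] at h2
  exact h2.symm

namespace FinAddProb

variable {A : Type*} [BooleanAlgebra A] {m : FinAddProb A} {Φ : LebesgueAlgebra → A}

/-- A measure with Lebesgue measure algebra has no atoms. -/
theorem MetricIsoVia.exists_mem_apply_lt (h : MetricIsoVia lebesgueAlgebraMeasure m Φ)
    (u : StoneSpace A) {ε : ℝ} (hε : 0 < ε) : ∃ F ∈ u.carrier, m F < ε := by
  obtain ⟨t, M, hM, hMε⟩ := exists_finset_sup_eq_top hε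
  have h1 : m (t.sup fun i => Φ (M i)) = 1 := by
    obtain ⟨e, he⟩ := h
    have h2 : m.cls (t.sup fun i => Φ (M i)) = m.cls ⊤ := by
      rw [Finset.apply_sup_eq_sup_comp (s := t) (f := fun i => Φ (M i)) m.cls (fun _ _ => rfl) rfl]
      have h3 : m.cls ∘ (fun i => Φ (M i)) = e ∘ M := funext fun i => (he (M i)).1.symm
      rw [h3, ← map_finset_sup, hM, OrderIso.map_top]
      rfl
    rw [m.apply_eq_of_null (m.cls_eq_cls.1 h2)]
    exact m.top'
  rcases u.mem_or_compl_mem' (t.sup fun i => Φ (M i)) with hu | hu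
  · obtain ⟨i, -, hi⟩ := u.exists_mem_of_sup_mem t _ hu
    refine ⟨_, hi, ?_⟩
    rw [h.apply_eq]
    exact hMε i
  · refine ⟨_, hu, ?_⟩
    rwa [apply_compl, h1, sub_self]

theorem MetricIsoVia.orthogonal_of_mem_convDirac (h : MetricIsoVia lebesgueAlgebraMeasure m Φ)
    {ν : RadonProb (StoneSpace A)} (hν : ν ∈ convDirac Set.univ) :
    m.Orthogonal (RadonProb.toFinAddProb ν) := by
  intro δ hδ
  obtain ⟨t, -, ht⟩ := mem_convDirac_iff.1 hν
  have hpos : 0 < δ / (t.card + 1) := by positivity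
  choose F hF hFδ using fun u => h.exists_mem_apply_lt u hpos
  refine ⟨(t.sup F)ᶜ, ?_, ?_⟩
  · rw [apply_compl]
    have h1 : m (t.sup F) ≤ t.card * (δ / (t.card + 1)) := by
      refine (m.apply_finset_sup_le t F).trans ?_
      refine (Finset.sum_le_sum fun i _ => (hFδ i).le).trans ?_
      rw [Finset.sum_const, nsmul_eq_mul]
    have h2 : t.card * (δ / (t.card + 1)) < δ := by
      rw [mul_div_assoc', div_lt_iff₀ (by positivity)]
      linarith
    linarith
  · refine lt_of_le_of_lt (le_of_eq ?_) hδ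
    change (ν.1 : Measure (StoneSpace A)).real _ = 0
    have h3 : (ν.1 : Measure (StoneSpace A)) (StoneSpace.basic (t.sup F)ᶜ) = 0 := by
      refine measure_eq_zero_iff_ae_notMem.2 ?_
      filter_upwards [ht] with u hu hu'
      rw [StoneSpace.basic_compl] at hu'
      exact hu' (u.mem_of_le' _ _ (Finset.le_sup hu) (hF u))
    rw [Measure.real, h3, ENNReal.toReal_zero]

end FinAddProb

/-! ### Orthogonality to sequential limits -/

theorem sum_geometric_two_le_two (t : Finset ℕ) : ∑ k ∈ t, (1 / 2 : ℝ) ^ k ≤ 2 :=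
  (summable_geometric_two.sum_le_tsum t fun k _ => by positivity).trans tsum_geometric_two.le

/-- A countable family in the Lebesgue algebra has a lower bound whose complement has measure at
most the sum of the measures of the complements. -/
theorem exists_le_forall_lebesgueAlgebra (M : ℕ → LebesgueAlgebra) {e : ℕ → ℝ}
    (he : Summable e) (hM : ∀ k, 1 - lebesgueAlgebraMeasure (M k) ≤ e k) :
    ∃ N, (∀ k, N ≤ M k) ∧ 1 - lebesgueAlgebraMeasure N ≤ ∑' k, e k := by
  choose s hs using fun k => borelLebesgue.cls_surj (M k)
  have he0 (k : ℕ) : 0 ≤ e k := by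
    refine le_trans ?_ (hM k)
    rw [← lebesgueAlgebraMeasure.apply_compl]
    exact lebesgueAlgebraMeasure.nonneg' _
  let S : {s : Set unitInterval // MeasurableSet s} :=
    ⟨⋂ k, (s k).1, MeasurableSet.iInter fun k => (s k).2⟩
  refine ⟨borelLebesgue.cls S, fun k => ?_, ?_⟩
  · rw [← hs k, FinAddProb.cls_le_cls]
    have : S ≤ s k := Set.iInter_subset (fun k => (s k).1) k
    rw [sdiff_eq_bot_iff.2 this, FinAddProb.apply_bot]
  · have h1 : 1 - lebesgueAlgebraMeasure (borelLebesgue.cls S) = borelLebesgue Sᶜ :=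
      (borelLebesgue.apply_compl S).symm
    have h2 (k : ℕ) : borelLebesgue (s k)ᶜ ≤ e k := by
      rw [borelLebesgue.apply_compl]
      refine le_trans (le_of_eq ?_) (hM k)
      rw [← hs k]
      rfl
    rw [h1]
    change (volume : Measure unitInterval).real (⋂ k, (s k).1)ᶜ ≤ _
    rw [Set.compl_iInter]
    refine ENNReal.toReal_le_of_le_ofReal (tsum_nonneg he0) ?_
    rw [ENNReal.ofReal_tsum_of_nonneg he0 he]
    refine (measure_iUnion_le _).trans (ENNReal.tsum_le_tsum fun k => ?_)
    exact (ENNReal.le_ofReal_iff_toReal_le (measure_ne_top _ _) (he0 k)).2 (h2 k)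

/-- If each sequence `f k` of nonnegative numbers tends to `0`, then finite sums of terms `f k n`
over sets of `k` growing slowly with `n` tend to `0` too; the index `k` takes part from `g k` on. -/
theorem exists_tendsto_sum_ite {f : ℕ → ℕ → ℝ} (hf0 : ∀ k n, 0 ≤ f k n)
    (hf : ∀ k, Tendsto (f k) atTop (𝓝 0)) :
    ∃ g : ℕ → ℕ, Tendsto
      (fun n => ∑ k ∈ Finset.range (n + 1), if g k ≤ n then f k n else 0) atTop (𝓝 0) := by
  have h1 (k : ℕ) : ∃ N, ∀ n ≥ N, f k n < (1 / 2) ^ k :=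
    eventually_atTop.1 ((hf k).eventually_lt_const (by positivity))
  choose g hg using h1
  refine ⟨fun k => max k (g k), ?_⟩
  have h2 : Tendsto (fun n => ∑' k, if max k (g k) ≤ n then f k n else 0) atTop
      (𝓝 (∑' _k : ℕ, (0 : ℝ))) := by
    refine tendsto_tsum_of_dominated_convergence summable_geometric_two (fun k => ?_)
      (Eventually.of_forall fun n k => ?_)
    · refine squeeze_zero (fun n => ?_) (fun n => ?_) (hf k)
      · split_ifs
        exacts [hf0 k n, le_rfl]
      · split_ifs
        exacts [le_rfl, hf0 k n]
    · split_ifs with h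
      · rw [Real.norm_of_nonneg (hf0 k n)]
        exact (hg k n ((le_max_right _ _).trans h)).le
      · rw [norm_zero]
        positivity
  rw [tsum_zero] at h2
  refine h2.congr fun n => tsum_eq_sum fun k hk => if_neg fun h => hk ?_
  rw [Finset.mem_range]
  exact Nat.lt_succ_of_le ((le_max_left _ _).trans h)

section Canonical

variable {B : ℕ → Set ℕ} {𝔹 : ℕ → BooleanSubalgebra (Set ℕ)} {μ : ∀ n, FinAddProb (𝔹 n)}
  {φ : ∀ n, LebesgueAlgebra → 𝔹 n} (hB : IsInfinitePartition B)
  (hφ : ∀ n, FinAddProb.MetricIsoVia lebesgueAlgebraMeasure (μ n) (φ n))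

theorem sum_block_le_one (p : FinAddProb (canonicalAlgebra B 𝔹 μ φ)) (t : Finset ℕ) :
    ∑ n ∈ t, p (block hB hφ n) ≤ 1 := by
  have h : ∑ n ∈ t, p (block hB hφ n) = p (t.sup (block hB hφ)) := by
    induction t using Finset.induction_on with
    | empty => simp [p.apply_bot]
    | insert n t hn ih =>
      rw [Finset.sum_insert hn, Finset.sup_insert, p.sup', ih]
      rw [Finset.disjoint_sup_right]
      intro k hk
      refine disjoint_block hB hφ ?_
      rintro rfl
      exact hn hk
  rw [h, ← p.top']
  exact p.apply_mono le_top

/-- The sliding hump. If the `p k` converge to `p` on the canonical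
algebra, the canonical measure is orthogonal to every `p k`, and, for large `n`, the measure `μ n`
is orthogonal to the part of each `p k` on the `n`-th block, then the canonical measure is
orthogonal to `p`.

The separating set `D` is an infimum `L` of sets separating the canonical measure from the `q k`,
thinned out on each block. Finitely many blocks are deleted, so that `p` has little mass on the
other blocks together. On the `n`-th block, finitely many `q k` are made small by orthogonality;
the other `q k` are there almost as small as `p`. Beyond finitely many blocks, `D` is contained in
the set separating the canonical measure from `q k`, up to a set deleted at asymptotically no
cost. -/
theorem orthogonal_of_tendsto {p : FinAddProb (canonicalAlgebra B 𝔹 μ φ)}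
    {q : ℕ → FinAddProb (canonicalAlgebra B 𝔹 μ φ)}
    (hlim : ∀ A, Tendsto (fun k => q k A) atTop (𝓝 (p A)))
    (hq : ∀ k, (canonicalMeasure hB hφ).Orthogonal (q k)) (N : ℕ)
    (hblock : ∀ n ≥ N, ∀ k, ∀ η : ℝ, 0 < η → ∃ E : 𝔹 n, 1 - η < μ n E ∧
      ∀ A ≤ block hB hφ n, traceHom hB hφ n A ≤ E → q k A < η) :
    (canonicalMeasure hB hφ).Orthogonal p := by
  intro δ hδ
  -- sets `F k` separating the canonical measure from `q k`
  have he0 (k : ℕ) : 0 < δ / 4 * (1 / 2) ^ k := by positivity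
  have he1 (k : ℕ) : δ / 4 * (1 / 2) ^ k ≤ δ / 4 :=
    mul_le_of_le_one_right (by positivity) (pow_le_one₀ (by norm_num) (by norm_num))
  choose F hF hqF using fun k => hq k _ (he0 k)
  choose M hM using fun k => exists_asympRep hB hφ (F k)
  obtain ⟨L, hLM, hL⟩ := exists_le_forall_lebesgueAlgebra M
    (summable_geometric_two.mul_left (δ / 4)) (fun k => by
      have h1 := hF k
      rw [canonicalMeasure_eq hB hφ (hM k)] at h1
      linarith)
  rw [tsum_mul_left, tsum_geometric_two] at hL
  -- `F k` covers `L` asymptotically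
  have hcov (k : ℕ) : Tendsto (fun n => μ n (φ n L \ traceHom hB hφ n (F k))) atTop (𝓝 0) := by
    refine squeeze_zero (fun n => (μ n).nonneg' _) (fun n => ?_) (hM k)
    have h1 : φ n L \ traceHom hB hφ n (F k) ≤
        (φ n L \ φ n (M k)) ⊔ symmDiff (traceHom hB hφ n (F k)) (φ n (M k)) :=
      (sdiff_triangle _ (φ n (M k)) _).trans (sup_le_sup_left (by
        rw [symmDiff_comm]
        exact le_sup_left) _)
    refine ((μ n).apply_mono h1).trans (((μ n).apply_sup_le _ _).trans ?_)
    rw [(hφ n).map_sdiff_of_le (hLM k), zero_add]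
  obtain ⟨g, hg⟩ := exists_tendsto_sum_ite (fun k n => (μ n).nonneg' _) hcov
  -- the tail of the `p`-measures of the blocks
  have hsum : Summable fun n => p (block hB hφ n) :=
    summable_of_sum_le (fun n => p.nonneg' _) (sum_block_le_one hB hφ p)
  obtain ⟨N', hNN', htail⟩ : ∃ N' ≥ N, ∀ G,
      ∑ n ∈ Finset.Ico N' G, p (block hB hφ n) ≤ δ / 8 := by
    obtain ⟨t, ht⟩ := summable_iff_vanishing_norm.1 hsum (δ / 8) (by positivity)
    obtain ⟨b, hb⟩ := t.bddAbove
    refine ⟨max N (b + 1), le_max_left _ _, fun G => ?_⟩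
    refine (le_abs_self _).trans (ht _ (Finset.disjoint_left.2 fun n hn hnt => ?_)).le
    have h1 := hb hnt
    have h2 := (le_max_right _ _).trans (Finset.mem_Ico.1 hn).1
    omega
  -- from the index `h n` on, `q k` has almost the measure of `p` on the `n`-th block
  have hd0 (n : ℕ) : 0 < δ / 8 * (1 / 2) ^ n := by positivity
  have hh (n : ℕ) : ∃ h, ∀ k ≥ h, q k (block hB hφ n) <
      p (block hB hφ n) + δ / 8 * (1 / 2) ^ n :=
    eventually_atTop.1 ((hlim (block hB hφ n)).eventually_lt_const (by linarith [hd0 n]))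
  choose h hh using hh
  have hη0 (n k : ℕ) : 0 < δ / 8 * (1 / 2) ^ n * (1 / 2) ^ k := mul_pos (hd0 n) (by positivity)
  have hE (n k : ℕ) : ∃ E : 𝔹 n, N ≤ n → 1 - δ / 8 * (1 / 2) ^ n * (1 / 2) ^ k < μ n E ∧
      ∀ A ≤ block hB hφ n, traceHom hB hφ n A ≤ E →
        q k A < δ / 8 * (1 / 2) ^ n * (1 / 2) ^ k := by
    by_cases hn : N ≤ n
    · obtain ⟨E, hE⟩ := hblock n hn k _ (hη0 n k)
      exact ⟨E, fun _ => hE⟩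
    · exact ⟨⊥, fun h => absurd h hn⟩
  choose E hE using hE
  let R (n : ℕ) : 𝔹 n := (Finset.range (h n)).sup fun k => (E n k)ᶜ
  let Q (n : ℕ) : 𝔹 n := (Finset.range (n + 1)).sup fun k =>
    if g k ≤ n then φ n L \ traceHom hB hφ n (F k) else ⊥
  let S (n : ℕ) : 𝔹 n := if n < N' then ⊥ else φ n L \ (R n ⊔ Q n)
  have hR (n : ℕ) (hn : N' ≤ n) : μ n (R n) ≤ 2 * (δ / 8 * (1 / 2) ^ n) := by
    refine ((μ n).apply_finset_sup_le _ _).trans ?_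
    refine (Finset.sum_le_sum (g := fun k => δ / 8 * (1 / 2) ^ n * (1 / 2) ^ k)
      fun k _ => ?_).trans ?_
    · rw [(μ n).apply_compl]
      linarith [(hE n k (hNN'.trans hn)).1]
    · rw [← Finset.mul_sum, mul_comm]
      gcongr
      exact sum_geometric_two_le_two _
  have hQ (n : ℕ) : μ n (Q n) ≤ ∑ k ∈ Finset.range (n + 1),
      if g k ≤ n then μ n (φ n L \ traceHom hB hφ n (F k)) else 0 := by
    refine ((μ n).apply_finset_sup_le _ _).trans (Finset.sum_le_sum fun k _ => ?_)
    split_ifs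
    exacts [le_rfl, (μ n).apply_bot.le]
  have hS : AsympRep μ φ S L := by
    have hgeom : Tendsto (fun n : ℕ => 2 * (δ / 8 * (1 / 2 : ℝ) ^ n)) atTop (𝓝 0) := by
      simpa using ((tendsto_pow_atTop_nhds_zero_of_lt_one (r := (1 / 2 : ℝ)) (by norm_num)
        (by norm_num)).const_mul (δ / 8)).const_mul 2
    have hub := hgeom.add hg
    rw [add_zero] at hub
    refine squeeze_zero' (Eventually.of_forall fun n => (μ n).nonneg' _) ?_ hub
    filter_upwards [eventually_ge_atTop N'] with n hn
    have h1 : symmDiff (S n) (φ n L) ≤ R n ⊔ Q n := by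
      have h2 : S n = φ n L \ (R n ⊔ Q n) := if_neg hn.not_gt
      rw [h2, symmDiff_of_le sdiff_le, sdiff_sdiff_right_self]
      exact inf_le_right
    exact ((μ n).apply_mono h1).trans (((μ n).apply_sup_le _ _).trans
      (add_le_add (hR n hn) (hQ n)))
  set D := glue hB hφ S ⟨L, hS⟩ with hD
  refine ⟨D, ?_, ?_⟩
  · rw [hD, canonicalMeasure_glue hB hφ S hS]
    linarith
  -- on the `n`-th block, `q k` is at most the measure of `p` plus a summable error
  have hDblock (k n : ℕ) (hn : N' ≤ n) : q k (D ⊓ block hB hφ n) ≤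
      p (block hB hφ n) + δ / 8 * (1 / 2) ^ n := by
    by_cases hk : k < h n
    · have h1 : traceHom hB hφ n (D ⊓ block hB hφ n) ≤ E n k := by
        refine (OrderHomClass.mono (traceHom hB hφ n) inf_le_left).trans ?_
        rw [hD, traceHom_glue]
        have h2 : S n = φ n L \ (R n ⊔ Q n) := if_neg hn.not_gt
        rw [h2]
        have h3 : (E n k)ᶜ ≤ R n ⊔ Q n :=
          (Finset.le_sup (f := fun k => (E n k)ᶜ) (Finset.mem_range.2 hk)).trans le_sup_left
        refine (sdiff_le_sdiff_left h3).trans ?_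
        rw [sdiff_compl]
        exact inf_le_right
      have h4 := (hE n k (hNN'.trans hn)).2 _ inf_le_right h1
      have h5 : δ / 8 * (1 / 2) ^ n * (1 / 2) ^ k ≤ δ / 8 * (1 / 2) ^ n :=
        mul_le_of_le_one_right (hd0 n).le (pow_le_one₀ (by norm_num) (by norm_num))
      linarith [p.nonneg' (block hB hφ n)]
    · exact ((q k).apply_mono inf_le_right).trans (hh n k (not_lt.1 hk)).le
  have hDq (k : ℕ) : q k D ≤ 5 * δ / 8 := by
    -- beyond the index `G`, the set `D` is contained in `F k`
    set G := max k (g k) with hG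
    have hcover : D ≤ F k ⊔ (Finset.Ico N' G).sup fun n => D ⊓ block hB hφ n := by
      refine le_of_traceHom_le hB hφ fun n => ?_
      by_cases hnN : n < N'
      · rw [hD, traceHom_glue]
        exact (if_pos hnN : S n = ⊥).le.trans bot_le
      by_cases hnG : n < G
      · refine le_trans ?_ (OrderHomClass.mono (traceHom hB hφ n) (le_sup_of_le_right
          (Finset.le_sup (f := fun n => D ⊓ block hB hφ n)
            (Finset.mem_Ico.2 ⟨not_lt.1 hnN, hnG⟩))))
        rw [InfHomClass.map_inf, traceHom_block, inf_top_eq]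
      · refine le_trans ?_ (OrderHomClass.mono (traceHom hB hφ n) le_sup_left)
        have hGn := not_lt.1 hnG
        have h1 : φ n L \ traceHom hB hφ n (F k) ≤ R n ⊔ Q n := by
          refine le_sup_of_le_right ?_
          refine le_trans (le_of_eq ?_) (Finset.le_sup
            (f := fun k => if g k ≤ n then φ n L \ traceHom hB hφ n (F k) else ⊥)
            (Finset.mem_range.2 (Nat.lt_succ_of_le ((le_max_left _ _).trans hGn))))
          exact (if_pos ((le_max_right _ _).trans hGn)).symm
        rw [hD, traceHom_glue]
        have h2 : S n = φ n L \ (R n ⊔ Q n) := if_neg hnN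
        rw [h2]
        refine (sdiff_le_sdiff_left h1).trans ?_
        rw [sdiff_sdiff_right_self]
        exact inf_le_right
    have h1 : ∑ n ∈ Finset.Ico N' G, q k (D ⊓ block hB hφ n) ≤ δ / 8 + δ / 8 * 2 := by
      refine (Finset.sum_le_sum fun n hn => hDblock k n (Finset.mem_Ico.1 hn).1).trans ?_
      rw [Finset.sum_add_distrib, ← Finset.mul_sum]
      refine add_le_add (htail G) ?_
      gcongr
      exact sum_geometric_two_le_two _
    have h2 := (q k).apply_mono hcover
    have h3 := (q k).apply_sup_le (F k) ((Finset.Ico N' G).sup fun n => D ⊓ block hB hφ n)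
    have h4 := (q k).apply_finset_sup_le (Finset.Ico N' G) fun n => D ⊓ block hB hφ n
    linarith [hqF k, he1 k]
  refine lt_of_le_of_lt (le_of_tendsto' (hlim D) hDq) ?_
  linarith

/-- The canonical measure is orthogonal to the levels not exceeding some `a N`. -/
theorem orthogonalToLevel_canonicalMeasure {a : ℕ → Ordinal.{0}} (ha : Monotone a)
    (horth : ∀ n, ∀ β < a n, (μ n).OrthogonalToLevel β) {N : ℕ} (β : Ordinal.{0})
    (hβ : β ≤ a N) : (canonicalMeasure hB hφ).OrthogonalToLevel β := by
  induction β using WellFoundedLT.induction with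
  | ind β ih =>
    intro ν hν
    by_cases h0 : β = 0
    · subst h0
      exact (metricIsoVia_canonicalMap hB hφ).orthogonal_of_mem_convDirac (mem_seqLevel_zero.1 hν)
    · obtain ⟨s, hs, hlim⟩ := (mem_seqLevel_of_ne_zero h0).1 hν
      choose γ hγ hsγ using hs
      refine orthogonal_of_tendsto hB hφ (q := fun k => RadonProb.toFinAddProb (s k))
        (fun A => RadonProb.tendsto_real_of_isClopen hlim (StoneSpace.isClopen_basic A))
        (fun k => ih (γ k) (hγ k) ((hγ k).le.trans hβ) _ (hsγ k)) N fun n hn k η hη => ?_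
      exact exists_small_on_block hB hφ
        (horth n (γ k) ((hγ k).trans_le (hβ.trans (ha hn)))) (hsγ k) hη

end Canonical

theorem theorem2p3
    -- the fixed partition of `ω` into infinite sets
    (B : ℕ → Set ℕ) (hB_inf : ∀ n, (B n).Infinite)
    (hB_disj : Pairwise fun i j => Disjoint (B i) (B j)) (hB_cover : ⋃ n, B n = Set.univ)
    (𝔹 : ℕ → BooleanSubalgebra (Set ℕ)) (μ : ∀ n, FinAddProb (𝔹 n))
    -- a non-decreasing sequence of non-zero countable ordinals and its supremum
    (a : ℕ → Ordinal.{0}) (ha_mono : Monotone a) (ha_ne : ∀ n, a n ≠ 0)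
    (ha_countable : ∀ n, a n < Ordinal.omega 1)
    (α : Ordinal.{0}) (hα : IsLUB (Set.range a) α)
    (φ : ∀ n, LebesgueAlgebra → 𝔹 n)
    (hlevel : ∀ n, (μ n).MemLevel (a n))
    (horth : ∀ n, ∀ β < a n, (μ n).OrthogonalToLevel β)
    (hiso : ∀ n, FinAddProb.MetricIsoVia lebesgueAlgebraMeasure (μ n) (φ n)) :
    ∃ m : FinAddProb (canonicalAlgebra B 𝔹 μ φ),
      IsCanonicalMeasure B 𝔹 μ φ m ∧
      ((∃ n, a n = α) → m.MemLevel (α + 1) ∧ ∀ β ≤ α, m.OrthogonalToLevel β) ∧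
      ((¬ ∃ n, a n = α) → m.MemLevel α ∧ ∀ β < α, m.OrthogonalToLevel β) ∧
      ∃ Φ : LebesgueAlgebra → canonicalAlgebra B 𝔹 μ φ,
        FinAddProb.MetricIsoVia lebesgueAlgebraMeasure m Φ := by
  have hB : IsInfinitePartition B := ⟨hB_inf, hB_disj, hB_cover⟩
  have hle (n : ℕ) : a n ≤ α := hα.1 ⟨n, rfl⟩
  refine ⟨canonicalMeasure hB hiso, isCanonicalMeasure_canonicalMeasure hB hiso, ?_, ?_,
    canonicalMap hB hiso, metricIsoVia_canonicalMap hB hiso⟩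
  · rintro ⟨N, hN⟩
    refine ⟨memLevel_canonicalMeasure hB hiso fun n =>
      ⟨a n, Order.lt_add_one_iff.2 (hle n), hlevel n⟩, fun β hβ => ?_⟩
    exact orthogonalToLevel_canonicalMeasure hB hiso ha_mono horth β (hβ.trans hN.ge)
  · intro hne
    refine ⟨memLevel_canonicalMeasure hB hiso fun n =>
      ⟨a n, lt_of_le_of_ne (hle n) fun h => hne ⟨n, h⟩, hlevel n⟩, fun β hβ => ?_⟩
    obtain ⟨_, ⟨N, rfl⟩, hN⟩ := (lt_isLUB_iff hα).1 hβ
    exact orthogonalToLevel_canonicalMeasure hB hiso ha_mono horth β hN.le
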